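/- Let $A=\mathbb Z[x_s,x_t]$. For a commutative $A$-algebra $R$, let $2\mathcal{TL}_R$ be the two-colored Temperley–Lieb category over $R$: its objects are the finite alternating sequences of the colors $s,t$; write $n_u$ for the sequence of length $n+1$ ending in the color $u\in\{s,t\}$, pictured as $n$ points on a line separating $n+1$ regions. $\mathrm{Hom}(k_u,n_u)$ is the free $R$-module on the two-colored crossingless matchings with $k$ points on the bottom, $n$ points on top, and color $u$ on the far right, and there are no nonzero morphisms between objects with different colors on the far right. Composition is by stacking, where a circle surrounded by a region of color $v$ is removed at the cost of the factor $-x_v$. A top idempotent of $n_u$ over $R$ is an idempotent $e\in\mathrm{End}(n_u)$ which occurs in some finite decomposition of the identity of $n_u$ into indecomposable orthogonal idempotents and whose coefficient of the identity matching is nonzero. It is called a Jones–Wenzl projector, denoted $JW^{R}_{n_u}$, if moreover $e\circ \mathrm{Hom}(k_u,n_u)=0$ for all $0\le k<n$. Theorem. Let $\Bbbk$ be an $A$-algebra which is a Henselian local domain, and let $[2]_s,[2]_t\in\Bbbk$ be the images of $x_s,x_t$. Let $\widehat A=\Bbbk[[z_s,z_t]]$, regarded as an $A$-algebra via $x_v\mapsto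 [2]_v+z_v$ for $v\in\{s,t\}$, and let $Q$ be the fraction field of $\widehat A$, with the induced $A$-algebra structure. Let $n\ge 0$ and $u\in\{s,t\}$, and suppose that a Jones–Wenzl projector $JW^{\Bbbk}_{n_u}$ exists over $\Bbbk$. Then there is a unique Jones–Wenzl projector $JW^{\widehat A}_{n_u}$ over $\widehat A$ and a unique Jones–Wenzl projector $JW^{Q}_{n_u}$ over $Q$. Extension of scalars along $\widehat A\to\Bbbk$, $z_s,z_t\mapsto 0$, sends $JW^{\widehat A}_{n_u}$ to $JW^{\Bbbk}_{n_u}$, and extension of scalars along $\widehat A\hookrightarrow Q$ sends $JW^{\widehat A}_{n_u}$ to $JW^{Q}_{n_u}$. Consequently, for every two-colored crossingless matching $d$ from $n_u$ to $n_u$, the coefficient of $d$ in $JW^{\widehat A}_{n_u}$ maps to the coefficient of $d$ in $JW^{\Bbbk}_{n_u}$ under $\widehat A\to\Bbbk$ and to the coefficient of $d$ in $JW^{Q}_{n_u}$ under $\widehat A\to Q$. -/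

import Mathlib

open CategoryTheory

namespace TwoColorTL

/-! ### Colors and the base ring -/

/-- The two colors `s` (red) and `t` (blue). -/
inductive Color
  | s
  | t

/-- The other color. -/
def Color.swap : Color → Color
  | .s => .t
  | .t => .s

/-- The ring `A = ℤ[x_s, x_t]`; the variable `x_u` is `MvPolynomial.X u`. An `A`-algebra structure on
a commutative ring `R` is a ring homomorphism `BaseRing →+* R`. -/
abbrev BaseRing : Type := MvPolynomial Color ℤ

/-! ### Crossingless matchings

A crossingless matching in the strip, with `n` boundary points on the bottom and `m` on the top, is
recorded by numbering its `n + m` boundary points in the cyclic order of the boundary of the strip,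
starting from the region on the far right: first the bottom points from right to left (positions
`0, …, n - 1`), then the top points from left to right (positions `n, …, n + m - 1`). This opens the
strip up to a half plane whose boundary is the line carrying the positions; the far right region of
the strip contains the part of the line to the left of position `0` (and to the right of the last
position). A matching of the positions is an involution without fixed points; to avoid casts it is
extended to all of `ℕ` by fixing the numbers that are not positions. -/

/-- `σ` is a crossingless matching of the `N` points `0, …, N - 1` on a line: it is an involution of
`ℕ` whose fixed points are exactly the `x ≥ N`, and no two arcs `{x, σ x}`, `{y, σ y}` cross. -/
structure IsMatching (N : ℕ) (σ : ℕ → ℕ) : Prop where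
  invol : ∀ x, σ (σ x) = x
  fixed : ∀ x, σ x = x ↔ N ≤ x
  noncrossing : ∀ x y, ¬ (x < y ∧ y < σ x ∧ σ x < σ y)

/-- The increasing map from `ℕ` onto `ℕ` without the two numbers `i` and `i + 1`. -/
def skip (i x : ℕ) : ℕ := if x < i then x else x + 2

/-- The inverse of `skip i` (on numbers different from `i` and `i + 1`). -/
def unskip (i x : ℕ) : ℕ := if x < i then x else x - 2

/-- The other end of the strand starting at `x` (where `x ≠ i, i + 1`), after the points `i` and
`i + 1` have been joined by an arc. -/
def via (i : ℕ) (σ : ℕ → ℕ) (x : ℕ) : ℕ :=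
  if σ x = i then σ (i + 1) else if σ x = i + 1 then σ i else σ x

/-- Join the adjacent points `i` and `i + 1` by an arc, and renumber the remaining points in order.
If `i` and `i + 1` are matched to each other, this closes up a circle, which is discarded here and
accounted for in `circleFactor`. -/
def contract (i : ℕ) (σ : ℕ → ℕ) (x : ℕ) : ℕ := unskip i (via i σ (skip i x))

/-- Put a matching `σ` of `N` points and a matching `τ` side by side, `σ` to the left of `τ`. -/
def juxt (N : ℕ) (σ τ : ℕ → ℕ) (x : ℕ) : ℕ :=
  if x < N then σ x else τ (x - N) + N

/-- Join the `2 * m` points `n, …, n + 2 * m - 1` by `m` nested arcs, starting with the innermost pair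
`n + m - 1, n + m`. -/
def glue (n : ℕ) : ℕ → (ℕ → ℕ) → (ℕ → ℕ)
  | 0, σ => σ
  | m + 1, σ => glue n m (contract (n + m) σ)

/-- The color of the region just to the left of point `i`, if the region at the far left of the line
(to the left of point `0`) has color `u`: colors alternate. -/
def gapColor (u : Color) (i : ℕ) : Color := if Even i then u else u.swap

/-- The value of the circle closed up by joining `i` and `i + 1`: it is `-x_v` if there is such a
circle and `v` is the color of the region surrounding it, and `1` if no circle is closed up. -/
noncomputable def circleFactor (u : Color) (i : ℕ) (σ : ℕ → ℕ) : BaseRing :=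
  if σ i = i + 1 then -MvPolynomial.X (gapColor u i) else 1

/-- The product of the values of all circles closed up in the course of `glue n m σ`. -/
noncomputable def circleValue (u : Color) (n : ℕ) : ℕ → (ℕ → ℕ) → BaseRing
  | 0, _ => 1
  | m + 1, σ => circleFactor u (n + m) σ * circleValue u n m (contract (n + m) σ)

/-- The identity matching with `n` points on the bottom and `n` on the top. -/
def idWord (n : ℕ) (x : ℕ) : ℕ := if x < n + n then n + n - 1 - x else x

/-! ### Combinatorial facts: gluing is well defined, unital and associative -/

theorem skip_ne (i x : ℕ) : skip i x ≠ i ∧ skip i x ≠ i + 1 := by unfold skip; split_ifs <;> omega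
theorem skip_lt (i x y : ℕ) : skip i x < skip i y ↔ x < y := by unfold skip; split_ifs <;> omega
theorem skip_inj (i x y : ℕ) : skip i x = skip i y ↔ x = y := by unfold skip; split_ifs <;> omega
theorem skip_le {N i : ℕ} (hi : i ≤ N) (x : ℕ) : N + 2 ≤ skip i x ↔ N ≤ x := by
  unfold skip; split_ifs <;> omega
theorem skip_unskip {i x : ℕ} (h : x ≠ i) (h' : x ≠ i + 1) : skip i (unskip i x) = x := by
  unfold skip unskip; split_ifs <;> omega
theorem skip_skip {i j : ℕ} (h : i ≤ j) (x : ℕ) : skip i (skip j x) = skip (j + 2) (skip i x) := by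
  unfold skip; split_ifs <;> omega

theorem IsMatching.lt_iff {N : ℕ} {σ : ℕ → ℕ} (h : IsMatching N σ) (x : ℕ) : σ x < N ↔ x < N := by
  have h1 := h.invol x; have h2 := h.fixed x; have h3 := h.fixed (σ x); grind

theorem IsMatching.inj {N : ℕ} {σ : ℕ → ℕ} (h : IsMatching N σ) {x y : ℕ} : σ x = σ y ↔ x = y :=
  ⟨fun e => by rw [← h.invol x, e, h.invol], fun e => by rw [e]⟩

theorem IsMatching.eq_iff {N : ℕ} {σ : ℕ → ℕ} (h : IsMatching N σ) {x y : ℕ} : σ x = y ↔ x = σ y := by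
  rw [← h.inj, h.invol]

theorem IsMatching.ne {N : ℕ} {σ : ℕ → ℕ} (h : IsMatching N σ) {x : ℕ} (hx : x < N) : σ x ≠ x := by
  have := h.fixed x; omega

theorem via_ne {N i : ℕ} {σ : ℕ → ℕ} (h : IsMatching N σ) (hi : i + 2 ≤ N) {x : ℕ}
    (h1 : x ≠ i) (h2 : x ≠ i + 1) : via i σ x ≠ i ∧ via i σ x ≠ i + 1 := by
  have a1 := h.ne (x := i) (by omega)
  have a2 := h.ne (x := i + 1) (by omega)
  have := h.eq_iff (x := x) (y := i)
  have := h.eq_iff (x := x) (y := i + 1)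
  have := h.eq_iff (x := i) (y := i + 1)
  unfold via; grind

theorem skip_contract {N i : ℕ} {σ : ℕ → ℕ} (h : IsMatching N σ) (hi : i + 2 ≤ N) (x : ℕ) :
    skip i (contract i σ x) = via i σ (skip i x) := by
  have := via_ne h hi (skip_ne i x).1 (skip_ne i x).2
  exact skip_unskip this.1 this.2

theorem isMatching_contract {N i : ℕ} {σ : ℕ → ℕ} (h : IsMatching (N + 2) σ) (hi : i ≤ N) :
    IsMatching N (contract i σ) := by
  have f1 := h.ne (x := i) (by omega)
  have f2 := h.ne (x := i + 1) (by omega)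
  have f3 := h.invol i
  have f4 := h.invol (i + 1)
  have f5 := h.lt_iff i
  have f6 := h.lt_iff (i + 1)
  refine ⟨fun x => ?_, fun x => ?_, fun x y => ?_⟩
  · rw [← skip_inj i, skip_contract h (by omega), skip_contract h (by omega)]
    have := skip_ne i x
    generalize skip i x = x at *
    have b1 := h.invol x
    unfold via; grind
  · rw [← skip_inj i, skip_contract h (by omega), ← skip_le hi]
    have := skip_ne i x
    generalize skip i x = x at *
    have b1 := h.invol x
    have b2 := h.fixed x
    unfold via; grind
  · rw [← skip_lt i, ← skip_lt i y, ← skip_lt i (contract i σ x), skip_contract h (by omega),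
      skip_contract h (by omega)]
    have := skip_ne i x
    have := skip_ne i y
    generalize skip i x = x at *
    generalize skip i y = y at *
    have b1 := h.invol x
    have b2 := h.invol y
    have c := h.noncrossing
    have := c x y
    have := c x i
    have := c x (i+1)
    have := c y i
    have := c y (i+1)
    have := c i x
    have := c (i+1) x
    have := c i y
    have := c (i+1) y
    have := c (σ i) x
    have := c (σ (i+1)) x
    have := c (σ i) y
    have := c (σ (i+1)) y
    have := c x (σ i)
    have := c x (σ (i+1))
    have := c y (σ i)
    have := c y (σ (i+1))
    have := c (σ i) (i+1)
    have := c (σ (i+1)) i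
    have := c (σ (i+1)) (σ i)
    have := c (σ i) (σ (i+1))
    clear c
    unfold via; split_ifs <;> grind

theorem isMatching_juxt {N M : ℕ} {σ τ : ℕ → ℕ} (h : IsMatching N σ) (h' : IsMatching M τ) :
    IsMatching (N + M) (juxt N σ τ) := by
  refine ⟨fun x => ?_, fun x => ?_, fun x y => ?_⟩
  · have := h.lt_iff x; have := h.invol x; have := h'.invol (x - N)
    unfold juxt; grind
  · have := h.lt_iff x; have := h.fixed x; have := h'.fixed (x - N)
    unfold juxt; grind
  · have := h.lt_iff x; have := h.lt_iff y; have := h.noncrossing x y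
    have := h'.noncrossing (x - N) (y - N)
    unfold juxt; grind

theorem isMatching_idWord (n : ℕ) : IsMatching (n + n) (idWord n) := by
  refine ⟨fun x => ?_, fun x => ?_, fun x y => ?_⟩ <;> unfold idWord <;> grind

theorem contract_juxt_left {N M i : ℕ} {σ τ : ℕ → ℕ} (h : IsMatching (N + 2) σ) (h' : IsMatching M τ)
    (hi : i ≤ N) : contract i (juxt (N + 2) σ τ) = juxt N (contract i σ) τ := by
  funext x
  have hj : IsMatching (N + 2 + M) (juxt (N + 2) σ τ) := isMatching_juxt h h'
  rw [← skip_inj i, skip_contract hj (by omega)]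
  have a1 := h.lt_iff i
  have a2 := h.lt_iff (i + 1)
  by_cases hx : x < N
  · rw [show juxt N (contract i σ) τ x = contract i σ x from if_pos hx, skip_contract h (by omega)]
    have := skip_le hi x
    have e : ∀ y < N + 2, juxt (N + 2) σ τ y = σ y := fun y hy => if_pos hy
    unfold via
    rw [e _ (by omega), e i (by omega), e (i + 1) (by omega)]
  · rw [show juxt N (contract i σ) τ x = τ (x - N) + N from if_neg hx]
    have e : juxt (N + 2) σ τ (x + 2) = τ (x - N) + N + 2 := by
      unfold juxt
      rw [if_neg (by omega), show x + 2 - (N + 2) = x - N by omega]; omega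
    have e1 : skip i x = x + 2 := if_neg (by omega)
    unfold via
    rw [e1, e, if_neg (by omega), if_neg (by omega), skip, if_neg (by omega)]

theorem contract_juxt_right {N M i : ℕ} {σ τ : ℕ → ℕ} (h : IsMatching N σ) (h' : IsMatching M τ)
    (hi : i + 2 ≤ M) :
    contract (N + i) (juxt N σ τ) = juxt N σ (contract i τ) := by
  funext x
  rw [← skip_inj (N + i), skip_contract (isMatching_juxt h h') (by omega)]
  have e : ∀ y, juxt N σ τ (N + y) = τ y + N := fun y => by simp [juxt]
  by_cases hx : x < N
  · have := h.lt_iff x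
    simp [juxt, via, skip, Nat.lt_add_right, *]
    grind
  · obtain ⟨y, rfl⟩ : ∃ y, x = N + y := ⟨x - N, by omega⟩
    have e2 : ∀ y, skip (N + i) (N + y) = N + skip i y := fun y => by
      unfold skip; split_ifs <;> omega
    have e3 : juxt N σ (contract i τ) (N + y) = N + contract i τ y := by simp [juxt, add_comm]
    rw [e3, e2, e2, skip_contract h' hi]
    unfold via
    simp only [e, add_assoc]
    grind

theorem contract_comm {N i j : ℕ} {σ : ℕ → ℕ} (h : IsMatching (N + 2) σ) (hij : i ≤ j)
    (hj : j + 2 ≤ N) :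
    contract j (contract i σ) = contract i (contract (j + 2) σ) := by
  have key : ∀ (i k : ℕ) (τ ρ : ℕ → ℕ) (_ : ∀ x, skip i (τ x) = ρ (skip i x)) (x k1 : ℕ) 
      (_ : skip i k = k1) (_ : skip i (k + 1) = k1 + 1),
      skip i (via k τ x) = via k1 ρ (skip i x) := by
    intro i k τ ρ hτ x k1 h1 h2
    unfold via
    have e1 : (τ x = k) ↔ ρ (skip i x) = k1 := by rw [← hτ, ← h1, skip_inj]
    have e2 : (τ x = k + 1) ↔ ρ (skip i x) = k1 + 1 := by rw [← hτ, ← h2, skip_inj]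
    simp only [e1, e2]
    split_ifs <;> simp only [hτ, h1, h2]
  funext x
  have c1 : IsMatching N (contract i σ) := isMatching_contract h (by omega)
  have c2 : IsMatching N (contract (j + 2) σ) := isMatching_contract h (by omega)
  rw [← skip_inj j, ← skip_inj i, skip_contract c1 (by omega),
    key i j _ _ (skip_contract h (by omega)) _ (j + 2) (by unfold skip; split_ifs <;> omega)
      (by unfold skip; split_ifs <;> omega), skip_skip hij, skip_skip hij,
    skip_contract c2 (by omega),
    key (j + 2) i _ _ (skip_contract h (by omega)) _ i (by unfold skip; split_ifs <;> omega)
      (by unfold skip; split_ifs <;> omega)]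
  have n1 : skip (j + 2) (skip i x) ≠ i ∧ skip (j + 2) (skip i x) ≠ i + 1 := by
    rw [← skip_skip hij]; exact skip_ne _ _
  have n2 := skip_ne (j + 2) (skip i x)
  generalize skip (j + 2) (skip i x) = z at *
  have f1 := h.ne (x := i) (by omega)
  have f2 := h.ne (x := i + 1) (by omega)
  have f3 := h.ne (x := j + 2) (by omega)
  have f4 := h.ne (x := j + 2 + 1) (by omega)
  have g0 := h.invol z
  have g1 := h.invol i
  have g2 := h.invol (i + 1)
  have g3 := h.invol (j + 2)
  have g4 := h.invol (j + 2 + 1)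
  have d1 : i ≠ j + 2 := by omega
  have d5 : i ≠ i + 1 := by omega
  have d6 : j + 2 ≠ j + 2 + 1 := by omega
  have d2 : i + 1 ≠ j + 2 := by omega
  have d3 : i ≠ j + 2 + 1 := by omega
  have d4 : i + 1 ≠ j + 2 + 1 := by omega
  clear key c1 c2 hij hj h
  unfold via
  generalize i + 1 = i' at *
  generalize j + 2 + 1 = j' at *
  generalize j + 2 = j at *
  have := n1.1; have := n1.2; have := n2.1; have := n2.2
  clear n1 n2
  by_cases z1 : σ z = i
  · grind
  by_cases z2 : σ z = i'
  · grind
  by_cases z3 : σ z = j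
  · grind
  by_cases z4 : σ z = j'
  · grind
  simp only [z1, z2, z3, z4, if_false]

/-- Insert `q` nested arcs immediately before point `p` of the matching `σ`. -/
def ins (p q : ℕ) (σ : ℕ → ℕ) (x : ℕ) : ℕ :=
  if x < p then (if σ x < p then σ x else σ x + 2 * q)
  else if x < p + 2 * q then 2 * p + 2 * q - 1 - x else
    (if σ (x - 2 * q) < p then σ (x - 2 * q) else σ (x - 2 * q) + 2 * q)

theorem ins_lt {p q x : ℕ} {σ : ℕ → ℕ} (h : x < p) :
    ins p q σ x = if σ x < p then σ x else σ x + 2 * q := if_pos h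
theorem ins_mid {p q x : ℕ} {σ : ℕ → ℕ} (h : p ≤ x) (h' : x < p + 2 * q) :
    ins p q σ x = 2 * p + 2 * q - 1 - x := by
  unfold ins; rw [if_neg (by omega), if_pos h']
theorem ins_add {p q x : ℕ} {σ : ℕ → ℕ} (h : p ≤ x) :
    ins p q σ (x + 2 * q) = if σ x < p then σ x else σ x + 2 * q := by
  unfold ins; rw [if_neg (by omega), if_neg (by omega), show x + 2 * q - 2 * q = x by omega]

theorem ins_cases (p q x : ℕ) : x < p ∨ (p ≤ x ∧ x < p + 2 * q) ∨ ∃ y, p ≤ y ∧ x = y + 2 * q := by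
  by_cases h : x < p
  · exact .inl h
  by_cases h' : x < p + 2 * q
  · exact .inr (.inl ⟨by omega, h'⟩)
  · exact .inr (.inr ⟨x - 2 * q, by omega, by omega⟩)

theorem isMatching_ins {N p q : ℕ} {σ : ℕ → ℕ} (h : IsMatching N σ) (hp : p ≤ N) :
    IsMatching (N + 2 * q) (ins p q σ) := by
  refine ⟨fun x => ?_, fun x => ?_, fun x y => ?_⟩
  · rcases ins_cases p q x with hx | ⟨hx, hx'⟩ | ⟨x, hx, rfl⟩
    · rw [ins_lt hx]; have := h.invol x
      split_ifs with h1
      · rw [ins_lt h1, this, if_pos hx]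
      · rw [ins_add (by omega), this, if_pos hx]
    · rw [ins_mid hx hx', ins_mid (by omega) (by omega)]; omega
    · rw [ins_add hx]; have := h.invol x
      split_ifs with h1
      · rw [ins_lt h1, this, if_neg (by omega)]
      · rw [ins_add (by omega), this, if_neg (by omega)]
  · rcases ins_cases p q x with hx | ⟨hx, hx'⟩ | ⟨x, hx, rfl⟩
    · rw [ins_lt hx]; have := h.fixed x; split_ifs <;> omega
    · rw [ins_mid hx hx']; omega
    · rw [ins_add hx]; have := h.fixed x; split_ifs <;> omega
  · rcases ins_cases p q x with hx | ⟨hx, hx'⟩ | ⟨x, hx, rfl⟩ <;>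
    rcases ins_cases p q y with hy | ⟨hy, hy'⟩ | ⟨y, hy, rfl⟩ <;>
    have := h.noncrossing x y <;>
    simp only [ins_lt, ins_mid, ins_add, *] <;> (try split_ifs) <;> omega

theorem contract_ins_left {N p q : ℕ} {σ : ℕ → ℕ} (h : IsMatching N σ) (hp : p + 1 ≤ N) :
    contract p (ins (p + 1) (q + 1) σ) = ins p q σ := by
  funext x
  have hm := isMatching_ins (q := q + 1) h hp
  rw [← skip_inj p, skip_contract hm (by omega)]
  have e1 := h.eq_iff (x := x) (y := p)
  have e3 := h.ne (x := p) (by omega)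
  have e4 := h.invol p
  have v1 : ins (p + 1) (q + 1) σ (p + 1) = p + 2 * q + 2 := by
    rw [ins_mid] <;> omega
  have v2 : ins (p + 1) (q + 1) σ p = if σ p < p + 1 then σ p else σ p + 2 * (q + 1) :=
    ins_lt (by omega)
  unfold via
  rw [v1, v2]
  rcases ins_cases p q x with hx | ⟨hx, hx'⟩ | ⟨x, hx, rfl⟩
  · rw [show skip p x = x from if_pos hx, ins_lt hx, ins_lt (by omega)]
    unfold skip; split_ifs <;> omega
  · rw [show skip p x = x + 2 from if_neg (by omega), ins_mid hx hx', ins_mid (by omega) (by omega)]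
    unfold skip; split_ifs <;> omega
  · rw [show skip p (x + 2 * q) = x + 2 * q + 2 from if_neg (by omega), ins_add hx]
    have e1 := h.eq_iff (x := x) (y := p)
    by_cases hh : x = p
    · subst hh
      rw [ins_mid (by omega) (by omega)]
      unfold skip; split_ifs <;> omega
    · rw [show x + 2 * q + 2 = x + 2 * (q + 1) by omega, ins_add (by omega)]
      unfold skip; split_ifs <;> omega

theorem contract_ins_right {N p q : ℕ} {σ : ℕ → ℕ} (h : IsMatching N σ) (hp : p + 1 ≤ N) :
    contract (p + 2 * q + 1) (ins p (q + 1) σ) = ins (p + 1) q σ := by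
  funext x
  have hm := isMatching_ins (p := p) (q := q + 1) h (by omega)
  rw [← skip_inj (p + 2 * q + 1), skip_contract hm (by omega)]
  have e1 := h.eq_iff (x := x) (y := p)
  have e3 := h.ne (x := p) (by omega)
  have e4 := h.invol p
  have v1 : ins p (q + 1) σ (p + 2 * q + 1) = p := by
    rw [ins_mid] <;> omega
  have v2 : ins p (q + 1) σ (p + 2 * q + 1 + 1) =
      if σ p < p then σ p else σ p + 2 * (q + 1) := by
    rw [show p + 2 * q + 1 + 1 = p + 2 * (q + 1) by omega, ins_add (by omega)]
  unfold via
  rw [v1, v2]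
  rcases ins_cases (p + 1) q x with hx | ⟨hx, hx'⟩ | ⟨x, hx, rfl⟩
  · rw [show skip (p + 2 * q + 1) x = x from if_pos (by omega), ins_lt hx]
    by_cases hh : x = p
    · subst hh
      rw [ins_mid (by omega) (by omega)]
      unfold skip; split_ifs <;> omega
    · rw [ins_lt (by omega)]
      unfold skip; split_ifs <;> omega
  · rw [show skip (p + 2 * q + 1) x = x from if_pos (by omega), ins_mid hx hx',
      ins_mid (by omega) (by omega)]
    unfold skip; split_ifs <;> omega
  · rw [show skip (p + 2 * q + 1) (x + 2 * q) = x + 2 * (q + 1) by unfold skip; split_ifs <;> omega,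
      ins_add hx, ins_add (by omega)]
    have e1 := h.eq_iff (x := x) (y := p)
    unfold skip; split_ifs <;> omega

theorem ins_zero (p : ℕ) (σ : ℕ → ℕ) : ins p 0 σ = σ := by
  funext x; unfold ins; split_ifs <;> first | rfl | omega

theorem juxt_idWord_right {N q : ℕ} {σ : ℕ → ℕ} (h : IsMatching N σ) :
    juxt N σ (idWord q) = ins N q σ := by
  funext x
  have := h.lt_iff x
  have := h.fixed (x - 2 * q)
  unfold juxt idWord ins
  split_ifs <;> omega

theorem juxt_idWord_left (q : ℕ) (σ : ℕ → ℕ) :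
    juxt (q + q) (idWord q) σ = ins 0 q σ := by
  funext x
  have : x - (q + q) = x - 2 * q := by omega
  unfold juxt idWord ins
  rw [this]
  split_ifs <;> omega

theorem IsMatching.even {N : ℕ} {σ : ℕ → ℕ} (h : IsMatching N σ) : Even N := by
  have : (∑ x ∈ Finset.range N, (1 : ZMod 2)) = 0 :=
    Finset.sum_involution (fun x _ => σ x) (fun _ _ => by decide)
      (fun x hx _ => h.ne (Finset.mem_range.1 hx))
      (fun x hx => Finset.mem_range.2 ((h.lt_iff x).2 (Finset.mem_range.1 hx)))
      (fun x _ => h.invol x)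
  simpa [ZMod.natCast_eq_zero_iff_even] using this

theorem IsMatching.even_add {N : ℕ} {σ : ℕ → ℕ} (h : IsMatching N σ) {x : ℕ} (hx : x < σ x) :
    Even (x + σ x + 1) := by
  have : (∑ x ∈ Finset.Ioo x (σ x), (1 : ZMod 2)) = 0 := by
    refine Finset.sum_involution (fun x _ => σ x) (fun _ _ => by decide) (fun y hy _ => ?_)
      (fun y hy => ?_) (fun x _ => h.invol x)
    · rw [Finset.mem_Ioo] at hy
      have := h.lt_iff x; have := h.fixed x; exact h.ne (by omega)
    · rw [Finset.mem_Ioo] at hy ⊢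
      have a1 := h.noncrossing x y
      have a2 := h.noncrossing (σ y) x
      have a3 := h.eq_iff (x := y) (y := x)
      have a4 := h.inj (x := y) (y := x)
      rw [h.invol] at a2
      omega
  have := (ZMod.natCast_eq_zero_iff_even (n := σ x - x - 1)).1 (by simpa using this)
  grind

theorem juxt_assoc (N M : ℕ) (σ τ ρ : ℕ → ℕ) :
    juxt N σ (juxt M τ ρ) = juxt (N + M) (juxt N σ τ) ρ := by
  funext x; unfold juxt
  have : x - N - M = x - (N + M) := by omega
  rw [this]
  split_ifs <;> omega

theorem isMatching_glue {n m N : ℕ} {σ : ℕ → ℕ} (h : IsMatching (n + 2 * m + N) σ) :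
    IsMatching (n + N) (glue n m σ) := by
  induction m generalizing σ with
  | zero => exact h
  | succ m ih =>
    refine ih (isMatching_contract ?_ (by omega))
    rwa [show n + 2 * m + N + 2 = n + 2 * (m + 1) + N by omega]

theorem contract_apply_eq_iff {N i k x : ℕ} {σ : ℕ → ℕ} (h : IsMatching N σ) (hi : i + 2 ≤ N) :
    contract i σ x = k ↔ via i σ (skip i x) = skip i k := by
  rw [← skip_inj i, skip_contract h hi]

theorem circleFactor_comm {N i j : ℕ} {σ : ℕ → ℕ} (u : Color) (h : IsMatching (N + 2) σ) (hij : i ≤ j)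
    (hj : j + 2 ≤ N) :
    circleFactor u i σ * circleFactor u j (contract i σ) = circleFactor u (j + 2) σ * circleFactor u i (contract (j + 2) σ) := by
  have s1 : skip i j = j + 2 := by unfold skip; split_ifs <;> omega
  have s2 : skip i (j + 1) = j + 2 + 1 := by unfold skip; split_ifs <;> omega
  have s3 : skip (j + 2) i = i := by unfold skip; split_ifs <;> omega
  have s4 : skip (j + 2) (i + 1) = i + 1 := by unfold skip; split_ifs <;> omega
  have g : gapColor u (j + 2) = gapColor u j := by simp [gapColor, Nat.even_add]
  unfold circleFactor
  simp only [contract_apply_eq_iff h (show i + 2 ≤ N + 2 by omega),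
    contract_apply_eq_iff h (show j + 2 + 2 ≤ N + 2 by omega), s1, s2, s3, s4, g]
  have p1 := h.even_add (x := i)
  have n1 := h.noncrossing i (i + 1)
  have a1 := h.invol i
  have a2 := h.invol (i + 1)
  have a3 := h.invol (j + 2)
  have a4 := h.invol (j + 2 + 1)
  have a5 := h.ne (x := i) (by omega)
  have a6 := h.ne (x := i + 1) (by omega)
  have a7 := h.ne (x := j + 2) (by omega)
  have a8 := h.ne (x := j + 2 + 1) (by omega)
  unfold via
  by_cases c1 : σ i = i + 1 <;> by_cases c2 : σ (j + 2) = j + 2 + 1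
  · have : σ (i + 1) = i := by rw [← c1, a1]
    have : σ (j + 2 + 1) = j + 2 := by rw [← c2, a3]
    grind
  · have : σ (i + 1) = i := by rw [← c1, a1]
    grind
  · have : σ (j + 2 + 1) = j + 2 := by rw [← c2, a3]
    grind
  · rw [if_neg c1, if_neg c2]
    by_cases c3 : σ i = j + 2 + 1 ∧ σ (i + 1) = j + 2
    · obtain ⟨c3, c4⟩ := c3
      have c5 : σ (j + 2) = i + 1 := by rw [← c4, a2]
      have : gapColor u i = gapColor u j := by
        have := p1 (by omega)
        rw [c3] at this
        have e : Even i ↔ Even j := by grind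
        exact if_congr e rfl rfl
      rw [this]
      grind
    · rw [if_neg, if_neg] <;> grind

theorem glue_contract {n m N j : ℕ} {σ : ℕ → ℕ} (h : IsMatching (N + 2 * m + 2) σ)
    (hj : n + j ≤ N) :
    glue n m (contract (n + 2 * m + j) σ) = contract (n + j) (glue n m σ) := by
  induction m generalizing σ with
  | zero => rfl
  | succ m ih =>
    have : contract (n + m) (contract (n + 2 * m + j + 2) σ) =
        contract (n + 2 * m + j) (contract (n + m) σ) :=
      (contract_comm h (by omega) (by omega)).symm
    rw [glue, glue, show n + 2 * (m + 1) + j = n + 2 * m + j + 2 by omega, this, ih]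
    exact isMatching_contract h (by omega)

theorem circle_contract {n m N j : ℕ} {σ : ℕ → ℕ} (u : Color) (h : IsMatching (N + 2 * m + 2) σ)
    (hj : n + j ≤ N) :
    circleValue u n m σ * circleFactor u (n + j) (glue n m σ) =
      circleFactor u (n + 2 * m + j) σ * circleValue u n m (contract (n + 2 * m + j) σ) := by
  induction m generalizing σ with
  | zero => simp [circleValue, glue]
  | succ m ih =>
    have e : contract (n + m) (contract (n + 2 * m + j + 2) σ) =
        contract (n + 2 * m + j) (contract (n + m) σ) :=
      (contract_comm h (by omega) (by omega)).symm
    have e2 := circleFactor_comm (i := n + m) (j := n + 2 * m + j) u h (by omega) (by omega)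
    have e3 := ih (σ := contract (n + m) σ) (isMatching_contract h (by omega))
    change circleFactor u (n + m) σ * circleValue u n m (contract (n + m) σ) * _ =
      _ * (circleFactor u (n + m) _ * circleValue u n m (contract (n + m) _))
    rw [show n + 2 * (m + 1) + j = n + 2 * m + j + 2 by omega, e, glue, mul_assoc, e3,
      ← mul_assoc, ← mul_assoc, e2]

theorem glue_glue {n m k N : ℕ} {σ : ℕ → ℕ} (h : IsMatching (n + 2 * m + 2 * k + N) σ) :
    glue n k (glue n m σ) = glue n m (glue (n + 2 * m) k σ) := by
  induction k generalizing σ with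
  | zero => rfl
  | succ k ih =>
    have h' : IsMatching (n + 2 * k + N + 2 * m + 2) σ := by
      rwa [show n + 2 * k + N + 2 * m + 2 = n + 2 * m + 2 * (k + 1) + N by omega]
    have h'' := isMatching_contract (i := n + 2 * m + k) h' (by omega)
    rw [show n + 2 * k + N + 2 * m = n + 2 * m + 2 * k + N by omega] at h''
    rw [glue, glue, ← ih h'', glue_contract h' (by omega)]

theorem circle_glue {n m k N : ℕ} {σ : ℕ → ℕ} (u : Color)
    (h : IsMatching (n + 2 * m + 2 * k + N) σ) :
    circleValue u n m σ * circleValue u n k (glue n m σ) =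
      circleValue u (n + 2 * m) k σ * circleValue u n m (glue (n + 2 * m) k σ) := by
  induction k generalizing σ with
  | zero => simp [circleValue, glue]
  | succ k ih =>
    have h' : IsMatching (n + 2 * k + N + 2 * m + 2) σ := by
      rwa [show n + 2 * k + N + 2 * m + 2 = n + 2 * m + 2 * (k + 1) + N by omega]
    have h'' := isMatching_contract (i := n + 2 * m + k) h' (by omega)
    rw [show n + 2 * k + N + 2 * m = n + 2 * m + 2 * k + N by omega] at h''
    change _ * (circleFactor u (n + k) _ * circleValue u n k (contract (n + k) (glue n m σ))) =
      circleFactor u _ _ * circleValue u (n + 2 * m) k (contract _ σ) * _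
    rw [← glue_contract h' (by omega), ← mul_assoc, circle_contract u h' (by omega), mul_assoc,
      ih h'', mul_assoc]
    rfl

theorem glue_juxt_left {n m N M : ℕ} {σ τ : ℕ → ℕ} (h : IsMatching (n + 2 * m + N) σ)
    (h' : IsMatching M τ) (u : Color) :
    glue n m (juxt (n + 2 * m + N) σ τ) = juxt (n + N) (glue n m σ) τ ∧
      circleValue u n m (juxt (n + 2 * m + N) σ τ) = circleValue u n m σ := by
  induction m generalizing σ with
  | zero => exact ⟨rfl, rfl⟩
  | succ m ih =>
    rw [show n + 2 * (m + 1) + N = n + 2 * m + N + 2 by omega] at h ⊢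
    have := ih (isMatching_contract (i := n + m) h (by omega))
    rw [glue, glue, contract_juxt_left h h' (by omega), circleValue, circleValue, circleFactor, circleFactor,
      contract_juxt_left h h' (by omega), this.1, this.2]
    refine ⟨rfl, ?_⟩
    rw [show juxt (n + 2 * m + N + 2) σ τ (n + m) = σ (n + m) from if_pos (by omega)]

theorem glue_juxt_right {n m N M : ℕ} {σ τ : ℕ → ℕ} (h' : IsMatching (n + 2 * m + N) τ)
    (h : IsMatching M σ) (u : Color) :
    glue (M + n) m (juxt M σ τ) = juxt M σ (glue n m τ) ∧
      circleValue u (M + n) m (juxt M σ τ) = circleValue u n m τ := by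
  induction m generalizing τ with
  | zero => exact ⟨rfl, rfl⟩
  | succ m ih =>
    rw [show n + 2 * (m + 1) + N = n + 2 * m + N + 2 by omega] at h'
    have := ih (isMatching_contract (i := n + m) h' (by omega))
    have e := contract_juxt_right (i := n + m) h h' (by omega)
    rw [← add_assoc] at e
    rw [glue, glue, circleValue, circleValue, circleFactor, circleFactor, e, this.1, this.2]
    refine ⟨rfl, ?_⟩
    have g : gapColor u (M + n + m) = gapColor u (n + m) := by
      have := h.even
      have e : Even (M + n + m) ↔ Even (n + m) := by grind
      exact if_congr e rfl rfl
    have e : juxt M σ τ (M + (n + m)) = τ (n + m) + M := by simp [juxt]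
    rw [g, show M + n + m = M + (n + m) by omega, e]
    congr 1
    exact if_congr (by omega) rfl rfl

theorem glue_idWord_right {n m : ℕ} {σ : ℕ → ℕ} (h : IsMatching (n + m) σ) (u : Color) :
    glue n m (juxt (n + m) σ (idWord m)) = σ ∧ circleValue u n m (juxt (n + m) σ (idWord m)) = 1 := by
  rw [juxt_idWord_right h]
  have : ∀ q ≤ m, glue n q (ins (n + q) q σ) = σ ∧ circleValue u n q (ins (n + q) q σ) = 1 := by
    intro q hq
    induction q with
    | zero => exact ⟨ins_zero _ _, rfl⟩
    | succ q ih =>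
      have e := contract_ins_left (p := n + q) (q := q) h (by omega)
      rw [← add_assoc, glue, circleValue, circleFactor, e, (ih (by omega)).1, (ih (by omega)).2, if_neg]
      · simp
      · rw [ins_lt (by omega)]; have := h.ne (x := n + q) (by omega); split_ifs <;> omega
  exact this m le_rfl

theorem glue_idWord_left {n k : ℕ} {σ : ℕ → ℕ} (h : IsMatching (n + k) σ) (u : Color) :
    glue n n (juxt (n + n) (idWord n) σ) = σ ∧
      circleValue u n n (juxt (n + n) (idWord n) σ) = 1 := by
  rw [juxt_idWord_left]
  have : ∀ q j, j + q = n → glue n q (ins j q σ) = σ ∧ circleValue u n q (ins j q σ) = 1 := by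
    intro q
    induction q with
    | zero => exact fun j _ => ⟨ins_zero _ _, rfl⟩
    | succ q ih =>
      intro j hj
      have e := contract_ins_right (p := j) (q := q) h (by omega)
      have := ih (j + 1) (by omega)
      rw [glue, circleValue, circleFactor, show n + q = j + 2 * q + 1 by omega, e, this.1, this.2, if_neg]
      · simp
      · rw [ins_mid (by omega) (by omega)]; omega
  exact this n 0 (by omega)

/-! ### The two-colored Temperley-Lieb category -/

/-- An object: a finite alternating sequence of colors, given by the number `len` of points between its
`len + 1` regions and the color `right` of the last region. -/
structure Obj where
  /-- the number of points -/
  len : ℕ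
  /-- the color of the region on the far right -/
  right : Color

/-- Two-colored crossingless matchings with bottom boundary `X` and top boundary `Y`. The coloring of
the regions is determined by the color on the far right, which has to be the same for `X` and `Y`. If
`X` and `Y` have lengths of different parity then there are none. -/
@[ext]
structure Diagram (X Y : Obj) where
  /-- the matching of the boundary points: bottom right to left, then top left to right -/
  word : ℕ → ℕ
  isMatching : IsMatching (X.len + Y.len) word
  right_eq : X.right = Y.right

/-- The identity crossingless matching. -/
def Diagram.id (X : Obj) : Diagram X X := ⟨idWord X.len, isMatching_idWord X.len, rfl⟩

theorem isMatching_comp {n m k : ℕ} {σ τ : ℕ → ℕ} (h : IsMatching (n + m) σ)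
    (h' : IsMatching (m + k) τ) : IsMatching (n + 2 * m + k) (juxt (n + m) σ τ) := by
  have := isMatching_juxt h h'
  rwa [show n + m + (m + k) = n + 2 * m + k by omega] at this

/-- Stack `e` on top of `d` and remove the circles. With `Y.len = m`, the top points of `d` from right
to left are at positions `n + m - 1, …, n` of the juxtaposition, and the bottom points of `e` from
right to left are at positions `n + m, …, n + 2 * m - 1`. -/
def Diagram.comp {X Y Z : Obj} (d : Diagram X Y) (e : Diagram Y Z) : Diagram X Z where
  word := glue X.len Y.len (juxt (X.len + Y.len) d.word e.word)
  isMatching := isMatching_glue (isMatching_comp d.isMatching e.isMatching)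
  right_eq := d.right_eq.trans e.right_eq

/-- The product of the values of the circles appearing when `e` is stacked on top of `d`. -/
noncomputable def Diagram.circles {X Y Z : Obj} (d : Diagram X Y) (e : Diagram Y Z) : BaseRing :=
  circleValue X.right X.len Y.len (juxt (X.len + Y.len) d.word e.word)

theorem Diagram.comp_id {X Y : Obj} (d : Diagram X Y) :
    d.comp (Diagram.id Y) = d ∧ d.circles (Diagram.id Y) = 1 :=
  have h := glue_idWord_right d.isMatching X.right
  ⟨Diagram.ext h.1, h.2⟩

theorem Diagram.id_comp {X Y : Obj} (d : Diagram X Y) :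
    (Diagram.id X).comp d = d ∧ (Diagram.id X).circles d = 1 :=
  have h := glue_idWord_left d.isMatching X.right
  ⟨Diagram.ext h.1, h.2⟩

theorem Diagram.assoc {W X Y Z : Obj} (d : Diagram W X) (e : Diagram X Y) (f : Diagram Y Z) :
    (d.comp e).comp f = d.comp (e.comp f) ∧
      d.circles e * (d.comp e).circles f = e.circles f * d.circles (e.comp f) := by
  have h1 := glue_juxt_left (isMatching_comp d.isMatching e.isMatching) f.isMatching W.right
  have h2 := glue_juxt_right (isMatching_comp e.isMatching f.isMatching) d.isMatching W.right
  have h3 := isMatching_juxt (isMatching_comp d.isMatching e.isMatching) f.isMatching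
  rw [show W.len + 2 * X.len + Y.len + (Y.len + Z.len) =
    W.len + 2 * X.len + 2 * Y.len + Z.len by omega] at h3
  have e1 : juxt (W.len + X.len) d.word (juxt (X.len + Y.len) e.word f.word) =
      juxt (W.len + 2 * X.len + Y.len) (juxt (W.len + X.len) d.word e.word) f.word := by
    rw [juxt_assoc, show W.len + X.len + (X.len + Y.len) = W.len + 2 * X.len + Y.len by omega]
  rw [e1, show W.len + X.len + X.len = W.len + 2 * X.len by omega] at h2
  have h4 := glue_glue h3
  have h5 := circle_glue W.right h3
  rw [h1.1, h2.1] at h4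
  rw [h1.1, h1.2, h2.1, h2.2] at h5
  refine ⟨Diagram.ext h4, ?_⟩
  simp only [Diagram.circles, ← d.right_eq]
  exact h5

/-- The two-colored Temperley-Lieb category over the `A`-algebra `R` with structure map `φ`, on its
type of objects. -/
structure TL {R : Type*} [CommRing R] (φ : BaseRing →+* R) where
  /-- the underlying alternating sequence of colors -/
  obj : Obj

/-- The object with `n` points and color `u` on the far right. -/
abbrev ob {R : Type*} [CommRing R] (φ : BaseRing →+* R) (n : ℕ) (u : Color) : TL φ := ⟨⟨n, u⟩⟩

section Category

variable {R : Type*} [CommRing R] (φ : BaseRing →+* R)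

/-- Bilinear extension of the composition of diagrams. -/
noncomputable def homComp {X Y Z : Obj} (f : Diagram X Y →₀ R) (g : Diagram Y Z →₀ R) :
    Diagram X Z →₀ R :=
  f.sum fun d a => g.sum fun e b => Finsupp.single (d.comp e) (a * b * φ (d.circles e))

theorem homComp_single {X Y Z : Obj} (d : Diagram X Y) (e : Diagram Y Z) (a b : R) :
    homComp φ (Finsupp.single d a) (Finsupp.single e b) =
      Finsupp.single (d.comp e) (a * b * φ (d.circles e)) := by
  unfold homComp
  rw [Finsupp.sum_single_index, Finsupp.sum_single_index] <;> simp

theorem homComp_add {X Y Z : Obj} (f : Diagram X Y →₀ R) (g g' : Diagram Y Z →₀ R) :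
    homComp φ f (g + g') = homComp φ f g + homComp φ f g' := by
  unfold homComp
  rw [← Finsupp.sum_add]
  congr 1
  funext d a
  exact Finsupp.sum_add_index' (by simp) (by simp [mul_add, add_mul])

theorem add_homComp {X Y Z : Obj} (f f' : Diagram X Y →₀ R) (g : Diagram Y Z →₀ R) :
    homComp φ (f + f') g = homComp φ f g + homComp φ f' g := by
  unfold homComp
  refine Finsupp.sum_add_index' (by simp) fun d a b => ?_
  rw [← Finsupp.sum_add]
  simp [add_mul]

theorem homComp_zero {X Y Z : Obj} (f : Diagram X Y →₀ R) :
    homComp φ f (0 : Diagram Y Z →₀ R) = 0 := by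
  simp [homComp]

theorem zero_homComp {X Y Z : Obj} (g : Diagram Y Z →₀ R) :
    homComp φ (0 : Diagram X Y →₀ R) g = 0 := by
  simp [homComp]

theorem homComp_assoc {W X Y Z : Obj} (f : Diagram W X →₀ R) (g : Diagram X Y →₀ R)
    (h : Diagram Y Z →₀ R) :
    homComp φ (homComp φ f g) h = homComp φ f (homComp φ g h) := by
  induction f using Finsupp.induction_linear with
  | zero => simp only [zero_homComp]
  | add f f' hf hf' => simp only [add_homComp, hf, hf']
  | single d a =>
    induction g using Finsupp.induction_linear with
    | zero => simp only [zero_homComp, homComp_zero]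
    | add g g' hg hg' => simp only [add_homComp, homComp_add, hg, hg']
    | single e b =>
      induction h using Finsupp.induction_linear with
      | zero => simp only [homComp_zero]
      | add h h' hh hh' => simp only [homComp_add, hh, hh']
      | single k c =>
        have := Diagram.assoc d e k
        simp only [homComp_single, this.1]
        congr 1
        have e2 := congrArg φ this.2
        simp only [map_mul] at e2
        linear_combination a * b * c * e2

theorem homComp_id {X Y : Obj} (f : Diagram X Y →₀ R) :
    homComp φ f (Finsupp.single (Diagram.id Y) 1) = f := by
  induction f using Finsupp.induction_linear with
  | zero => simp only [zero_homComp]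
  | add f f' hf hf' => simp only [add_homComp, hf, hf']
  | single d a => simp [homComp_single, d.comp_id]

theorem id_homComp {X Y : Obj} (f : Diagram X Y →₀ R) :
    homComp φ (Finsupp.single (Diagram.id X) 1) f = f := by
  induction f using Finsupp.induction_linear with
  | zero => simp only [homComp_zero]
  | add f f' hf hf' => simp only [homComp_add, hf, hf']
  | single d a => simp [homComp_single, d.id_comp]

/-- Morphism spaces are free over `R` on the two-colored crossingless matchings. -/
noncomputable instance : Category (TL φ) where
  Hom X Y := Diagram X.obj Y.obj →₀ R
  id X := Finsupp.single (Diagram.id X.obj) 1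
  comp f g := homComp φ f g
  id_comp f := id_homComp φ f
  comp_id f := homComp_id φ f
  assoc f g h := homComp_assoc φ f g h

noncomputable instance : Preadditive (TL φ) where
  homGroup X Y := inferInstanceAs (AddCommGroup (Diagram X.obj Y.obj →₀ R))
  add_comp _ _ _ f f' g := add_homComp φ f f' g
  comp_add _ _ _ f g g' := homComp_add φ f g g'

variable {φ}

/-- The coefficient of a crossingless matching in a morphism. -/
def coeff {X Y : TL φ} (f : X ⟶ Y) (d : Diagram X.obj Y.obj) : R :=
  (show Diagram X.obj Y.obj →₀ R from f) d

/-- Extension of scalars along a homomorphism `ψ` of `A`-algebras; it applies `ψ` to all coefficients. -/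
noncomputable def baseChange {S : Type*} [CommRing S] {φ' : BaseRing →+* S} (ψ : R →+* S)
    (hψ : ψ.comp φ = φ') : TL φ ⥤ TL φ' where
  obj X := ⟨X.obj⟩
  map {X Y} f := Finsupp.mapRange ψ ψ.map_zero (show Diagram X.obj Y.obj →₀ R from f)
  map_id X := by
    change Finsupp.mapRange ψ _ (Finsupp.single _ _) = Finsupp.single _ _
    rw [Finsupp.mapRange_single, map_one]
  map_comp {X Y Z} f g := by
    change Finsupp.mapRange ψ _ (homComp φ f g) =
      homComp φ' (Finsupp.mapRange ψ _ f) (Finsupp.mapRange ψ _ g)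
    have hadd : ∀ {U V : Obj} (a b : Diagram U V →₀ R), Finsupp.mapRange ψ ψ.map_zero (a + b) =
        Finsupp.mapRange ψ ψ.map_zero a + Finsupp.mapRange ψ ψ.map_zero b :=
      fun a b => Finsupp.mapRange_add (map_add ψ) a b
    induction f using Finsupp.induction_linear with
    | zero => simp only [zero_homComp, Finsupp.mapRange_zero]
    | add f f' hf hf' => simp only [add_homComp, hadd, hf, hf']
    | single d a =>
      induction g using Finsupp.induction_linear with
      | zero => simp only [homComp_zero, Finsupp.mapRange_zero]
      | add g g' hg hg' => simp only [homComp_add, hadd, hg, hg']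
      | single e b =>
        simp only [homComp_single, Finsupp.mapRange_single, map_mul, ← hψ, RingHom.comp_apply]

end Category

/-! ### Jones-Wenzl projectors -/

/-- An idempotent `e ≠ 0` which is not the sum of two nonzero orthogonal idempotents. -/
structure IsIndecomposableIdempotent {E : Type*} [Ring E] (e : E) : Prop where
  idem : IsIdempotentElem e
  ne_zero : e ≠ 0
  indecomposable : ∀ a b : E, IsIdempotentElem a → IsIdempotentElem b → a * b = 0 → b * a = 0 →
    a + b = e → a = 0 ∨ b = 0

variable {R : Type*} [CommRing R] {φ : BaseRing →+* R}

/-- `e` is a top idempotent: it occurs in some decomposition of the identity into indecomposable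
orthogonal idempotents, and its coefficient of the identity matching is nonzero. -/
def IsTopIdempotent {X : TL φ} (e : End X) : Prop :=
  (∃ (d : ℕ) (f : Fin d → End X), CompleteOrthogonalIdempotents f ∧
    (∀ i, IsIndecomposableIdempotent (f i)) ∧ ∃ i, f i = e) ∧
  coeff (X := X) (Y := X) e (Diagram.id X.obj) ≠ 0

/-- `e` is a Jones-Wenzl projector on the object with `n` points and color `u` on the far right: it is
a top idempotent, and `e ∘ g = 0` for all morphisms `g` from the object with `k < n` points and color
`u` on the far right. -/
def IsJonesWenzl {n : ℕ} {u : Color} (e : End (ob φ n u)) : Prop :=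
  IsTopIdempotent e ∧ ∀ k < n, ∀ g : ob φ k u ⟶ ob φ n u, g ≫ e = 0

/-! ### The generic deformation of the base ring -/

section Deformation

variable (𝕜 : Type*) [CommRing 𝕜] [Algebra BaseRing 𝕜]

/-- The power series ring `𝕜⟦z_s, z_t⟧` as an `A`-algebra: `x_u ↦ [2]_u + z_u`, where `[2]_u` is the
image of `x_u` in `𝕜`. -/
noncomputable def deformation : BaseRing →+* MvPowerSeries Color 𝕜 :=
  MvPolynomial.eval₂Hom (Int.castRingHom _) fun u =>
    MvPowerSeries.C (algebraMap BaseRing 𝕜 (MvPolynomial.X u)) + MvPowerSeries.X u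

theorem constantCoeff_comp_deformation :
    (MvPowerSeries.constantCoeff (σ := Color) (R := 𝕜)).comp (deformation 𝕜) =
      algebraMap BaseRing 𝕜 := by
  refine MvPolynomial.ringHom_ext (fun r => ?_) fun u => ?_ <;> simp [deformation]

/-- Specialization `z_s = z_t = 0`: extension of scalars from `𝕜⟦z_s, z_t⟧` to `𝕜`. -/
noncomputable def specialization : TL (deformation 𝕜) ⥤ TL (algebraMap BaseRing 𝕜) :=
  baseChange MvPowerSeries.constantCoeff (constantCoeff_comp_deformation 𝕜)

/-- Extension of scalars from `𝕜⟦z_s, z_t⟧` to a (generic) algebra `Q` over it. -/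
noncomputable def generic (Q : Type*) [CommRing Q] [Algebra (MvPowerSeries Color 𝕜) Q] :
    TL (deformation 𝕜) ⥤
      TL ((algebraMap (MvPowerSeries Color 𝕜) Q).comp (deformation 𝕜)) :=
  baseChange (algebraMap (MvPowerSeries Color 𝕜) Q) rfl

end Deformation

end TwoColorTL

namespace TwoColorTL

/-! ### Inserting an arc -/

/-! Write `ε` for the coefficient of the identity matching (`idCoeff`) on `End(n_u)`. A nonidentity
matching has a cup joining two neighbouring top points (`exists_top_arc`), so it factors without
circles through `n - 2` points (`Diagram.exists_comp_cup`). Two consequences follow. First, `ε` is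
multiplicative, because a composite of matchings is the identity only if both factors are
(`idCoeff_comp`). Second, an endomorphism `e` that kills all morphisms from fewer points satisfies
`e * w = ε(w) • e` for every `w` (`KillsLower.mul_eq`).

Over a domain, Jones-Wenzl projectors are therefore exactly the `e` with `ε(e) = 1` that kill lower
morphisms (`isJonesWenzl_iff`). Idempotency and indecomposability follow from the formula for `e *
w`, and the required decomposition of `1` exists because orthogonal nonzero idempotents are linearly
independent. Reflection in a horizontal line turns the formula into its mirror image, and comparing
the two gives uniqueness (`KillsLower.unique`).

The main point is lifting along a surjective local homomorphism (`KillsLower.exists_lift`).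
Downstairs, `1 - e` acts as a unit on the ideal `ker ε` and on all morphisms from lower objects.
Lift it to `y` with `ε(y) = 0`. Composition with `y` is the identity after reduction on the lower
morphism spaces, so its determinant is a unit and it is bijective there; a correction by `ε` gives
the same on all of `End(n_u)`. This yields `x` with `ε(x) = 0` and `y ∘ x = y`, and `1 - x` is the
wanted lift. Applied to the constant coefficient of power series, this gives the projector over the
power series ring. Its image over the fraction field is again a projector, since the killing
condition need only be tested on matchings (`KillsLower.extend`). -/

/-- Off the new arc, insertion is just renumbering by `skip p`. With the values at `p` and `p + 1`
this determines `ins p 1 σ`, so the lemmas below can avoid its case distinction. -/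
theorem ins_one_apply (p : ℕ) (σ : ℕ → ℕ) (x : ℕ) :
    ins p 1 σ (skip p x) = skip p (σ x) := by
  unfold ins skip
  split_ifs <;> grind

theorem ins_one_self (p : ℕ) (σ : ℕ → ℕ) : ins p 1 σ p = p + 1 := by
  rw [ins_mid] <;> omega

theorem ins_one_succ (p : ℕ) (σ : ℕ → ℕ) : ins p 1 σ (p + 1) = p := by
  rw [ins_mid] <;> omega

/-- A map is determined by its values at `p`, `p + 1` and on the image of `skip p`. -/
theorem funext_skip (p : ℕ) {f g : ℕ → ℕ} (h0 : f p = g p) (h1 : f (p + 1) = g (p + 1))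
    (h : ∀ x, f (skip p x) = g (skip p x)) : f = g := by
  funext x
  by_cases hx : x = p
  · rw [hx, h0]
  by_cases hx' : x = p + 1
  · rw [hx', h1]
  rw [← skip_unskip hx hx', h]

/-- Since `p` and `p + 1` are joined to each other, no other strand is rerouted by `via`, and
reinserting the arc undoes the contraction. -/
theorem ins_one_contract {N p : ℕ} {σ : ℕ → ℕ} (h : IsMatching N σ) (hp : p + 2 ≤ N)
    (e : σ p = p + 1) : ins p 1 (contract p σ) = σ := by
  have e' : σ (p + 1) = p := by rw [← e, h.invol]
  refine funext_skip p ?_ ?_ fun x => ?_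
  · rw [ins_one_self, e]
  · rw [ins_one_succ, e']
  · rw [ins_one_apply, skip_contract h hp]
    have h1 := skip_ne p x
    have h2 := h.eq_iff (x := skip p x) (y := p)
    have h3 := h.eq_iff (x := skip p x) (y := p + 1)
    unfold via
    rw [if_neg (by omega), if_neg (by omega)]

/-- The inserted arc lies entirely to the right of the contracted pair, so the two operations are
independent up to the shift of the arc's position by `2`. -/
theorem contract_ins_one {N i j : ℕ} {σ : ℕ → ℕ} (h : IsMatching N σ) (hi : i + 2 ≤ N)
    (hij : i ≤ j) (hj : j + 2 ≤ N) :
    contract i (ins (j + 2) 1 σ) = ins j 1 (contract i σ) := by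
  have hm := isMatching_ins (p := j + 2) (q := 1) h hj
  have h1 := ins_one_self (j + 2) σ
  have h2 := ins_one_succ (j + 2) σ
  have s0 : skip (j + 2) i = i := by unfold skip; rw [if_pos]; omega
  have s1 : skip (j + 2) (i + 1) = i + 1 := by unfold skip; rw [if_pos]; omega
  have e0 := ins_one_apply (j + 2) σ i
  have e1 := ins_one_apply (j + 2) σ (i + 1)
  rw [s0] at e0
  rw [s1] at e1
  have t0 : skip i j = j + 2 := by unfold skip; rw [if_neg]; omega
  have t1 : skip i (j + 1) = j + 2 + 1 := by unfold skip; rw [if_neg]; omega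
  refine funext_skip j ?_ ?_ fun x => ?_
  · rw [← skip_inj i, skip_contract hm (by omega), ins_one_self, t0, t1, via, h1, if_neg (by omega),
      if_neg (by omega)]
  · rw [← skip_inj i, skip_contract hm (by omega), ins_one_succ, t0, t1, via, h2, if_neg (by omega),
      if_neg (by omega)]
  · rw [ins_one_apply, ← skip_inj i, skip_contract hm (by omega), skip_skip hij, skip_skip hij,
      skip_contract h hi]
    unfold via
    have a0 := skip_inj (j + 2) (σ (skip i x)) i
    have a1 := skip_inj (j + 2) (σ (skip i x)) (i + 1)
    rw [s0] at a0
    rw [s1] at a1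
    rw [ins_one_apply, e0, e1]
    simp only [a0, a1]
    split_ifs <;> rfl

theorem circleFactor_ins_one {i j : ℕ} (u : Color) (σ : ℕ → ℕ) (hij : i + 1 < j) :
    circleFactor u i (ins j 1 σ) = circleFactor u i σ := by
  have e0 := ins_one_apply j σ i
  have s0 : skip j i = i := by unfold skip; rw [if_pos]; omega
  rw [s0] at e0
  unfold circleFactor
  rw [e0]
  refine if_congr ?_ rfl rfl
  unfold skip
  split_ifs <;> omega

/-- Every contraction in `glue` takes place left of position `n + 2 * m`, so an arc among the later
points passes through unchanged and adds no circle. -/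
theorem glue_ins_one {n m N j : ℕ} {σ : ℕ → ℕ} (u : Color) (h : IsMatching (n + 2 * m + N) σ)
    (hj : j ≤ N) :
    glue n m (ins (n + 2 * m + j) 1 σ) = ins (n + j) 1 (glue n m σ) ∧
      circleValue u n m (ins (n + 2 * m + j) 1 σ) = circleValue u n m σ := by
  induction m generalizing σ with
  | zero => exact ⟨rfl, rfl⟩
  | succ m ih =>
    rw [show n + 2 * (m + 1) + N = n + 2 * m + N + 2 by omega] at h
    have e : contract (n + m) (ins (n + 2 * (m + 1) + j) 1 σ) =
        ins (n + 2 * m + j) 1 (contract (n + m) σ) := by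
      rw [show n + 2 * (m + 1) + j = n + 2 * m + j + 2 by omega]
      exact contract_ins_one h (by omega) (by omega) (by omega)
    have := ih (isMatching_contract (i := n + m) h (by omega))
    rw [glue, glue, circleValue, circleValue, e, this.1, this.2,
      circleFactor_ins_one u σ (by omega)]
    exact ⟨rfl, rfl⟩

theorem juxt_ins_one {N p : ℕ} {σ τ : ℕ → ℕ} (h : IsMatching N σ) :
    juxt N σ (ins p 1 τ) = ins (N + p) 1 (juxt N σ τ) := by
  funext x
  have a := h.lt_iff x
  have b : ∀ y, x - N - y = x - y - N := by intro y; omega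
  have c : τ (x - N - 2) = τ (x - 2 - N) := by rw [b]
  unfold juxt ins
  simp only [mul_one]
  split_ifs <;> omega

theorem exists_top_arc {n : ℕ} {σ : ℕ → ℕ} (h : IsMatching (n + n) σ) (hσ : σ ≠ idWord n) :
    ∃ j, j + 2 ≤ n ∧ σ (n + j) = n + j + 1 := by
  by_contra hno
  push Not at hno
  -- no arc joins two top points
  have hlow : ∀ l x, n ≤ x → σ x = x + l → x + l < n + n → 0 < l → False := by
    intro l
    induction l using Nat.strong_induction_on with
    | _ l ih =>
      intro x hx e hl hpos
      by_cases h1 : l = 1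
      · subst h1
        refine hno (x - n) (by omega) ?_
        rw [show n + (x - n) = x by omega]; exact e
      -- The point `x + 1` lies under the arc from `x` to `x + l`, so its partner does too, and the
      -- arc at `x + 1` is shorter.
      · have a1 := h.noncrossing x (x + 1)
        have a2 := h.noncrossing (σ (x + 1)) x
        have a3 := h.ne (x := x + 1) (by omega)
        have a4 := h.eq_iff (x := x + 1) (y := x)
        have a5 := h.inj (x := x + 1) (y := x)
        rw [h.invol] at a2
        have : x + 1 < σ (x + 1) ∧ σ (x + 1) < x + l := by omega
        exact ih (σ (x + 1) - (x + 1)) (by omega) (x + 1) (by omega) (by omega) (by omega) (by omega)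
  have htop : ∀ x, n ≤ x → x < n + n → σ x < n := by
    intro x hx hx'
    by_contra hc
    have b1 := (h.lt_iff x).2 hx'
    have b2 := h.ne hx'
    rcases lt_or_gt_of_ne b2 with b | b
    · exact hlow (x - σ x) (σ x) (by omega) (by rw [h.invol]; omega) (by omega) (by omega)
    · exact hlow (σ x - x) x hx (by omega) (by omega) (by omega)
  -- so `σ` is decreasing on the top points
  have hdec : ∀ x y, n ≤ x → x < y → y < n + n → σ y < σ x := by
    intro x y hx hxy hy
    have c1 := htop x hx (by omega)
    have c2 := htop y (by omega) hy
    have c3 := h.noncrossing (σ x) (σ y)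
    have c4 := h.inj (x := x) (y := y)
    rw [h.invol, h.invol] at c3
    omega
  -- The `n` top values are strictly decreasing and lie in `0, …, n - 1`. Counting from the first
  -- top point bounds them above, counting from the last bounds them below, and the two bounds
  -- coincide.
  have hub : ∀ j, j < n → σ (n + j) + j < n := by
    intro j
    induction j with
    | zero => intro hj; have := htop n le_rfl (by omega); simpa using this
    | succ j ih =>
      intro hj
      have := ih (by omega)
      have := hdec (n + j) (n + (j + 1)) (by omega) (by omega) (by omega)
      omega
  have hlb : ∀ j, j < n → j ≤ σ (n + n - 1 - j) := by
    intro j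
    induction j with
    | zero => intro; omega
    | succ j ih =>
      intro hj
      have := ih (by omega)
      have := hdec (n + n - 1 - (j + 1)) (n + n - 1 - j) (by omega) (by omega) (by omega)
      omega
  have hval : ∀ x, n ≤ x → x < n + n → σ x = n + n - 1 - x := by
    intro x hx hx'
    have d1 := hub (x - n) (by omega)
    have d2 := hlb (n + n - 1 - x) (by omega)
    rw [show n + (x - n) = x by omega] at d1
    rw [show n + n - 1 - (n + n - 1 - x) = x by omega] at d2
    omega
  refine hσ (funext fun x => ?_)
  unfold idWord
  split_ifs with hx
  · by_cases hx' : n ≤ x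
    · exact hval x hx' hx
    · rw [h.eq_iff, hval _ (by omega) (by omega)]; omega
  · exact (h.fixed x).2 (by omega)

/-! ### Reversing a matching -/

/-- The reflection of a matching of `N` points. -/
def rev (N : ℕ) (σ : ℕ → ℕ) (x : ℕ) : ℕ := if x < N then N - 1 - σ (N - 1 - x) else x

theorem rev_apply {N x : ℕ} {σ : ℕ → ℕ} (hx : x < N) : rev N σ x = N - 1 - σ (N - 1 - x) :=
  if_pos hx

theorem isMatching_rev {N : ℕ} {σ : ℕ → ℕ} (h : IsMatching N σ) : IsMatching N (rev N σ) := by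
  have key : ∀ x, (x < N ∧ ∃ y, y < N ∧ x = N - 1 - y ∧ rev N σ x = N - 1 - σ y) ∨
      (N ≤ x ∧ rev N σ x = x) := by
    intro x
    by_cases hx : x < N
    · exact .inl ⟨hx, N - 1 - x, by omega, by omega, rev_apply hx⟩
    · exact .inr ⟨by omega, if_neg hx⟩
  refine ⟨fun x => ?_, fun x => ?_, fun x y => ?_⟩
  · rcases key x with ⟨hx, y, hy, e, r⟩ | ⟨hx, r⟩
    · have := (h.lt_iff y).2 hy
      rw [r, rev_apply (by omega), show N - 1 - (N - 1 - σ y) = σ y by omega, h.invol, e]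
    · rw [r, r]
  · rcases key x with ⟨hx, y, hy, e, r⟩ | ⟨hx, r⟩
    · have := (h.lt_iff y).2 hy
      have := h.ne hy
      omega
    · omega
  · rcases key x with ⟨hx, x', hx', ex, rx⟩ | ⟨hx, rx⟩ <;>
      rcases key y with ⟨hy, y', hy', ey, ry⟩ | ⟨hy, ry⟩
    · have a1 := (h.lt_iff x').2 hx'
      have a2 := (h.lt_iff y').2 hy'
      -- A crossing `x < y < rev x < rev y`, read backwards, is the crossing `σ y' < σ x' < y' < x'`
      -- of `σ`.
      have := h.noncrossing (σ y') (σ x')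
      rw [h.invol, h.invol] at this
      omega
    all_goals (try have a1 := (h.lt_iff x').2 hx'); omega

theorem rev_rev {N : ℕ} {σ : ℕ → ℕ} (h : IsMatching N σ) : rev N (rev N σ) = σ := by
  funext x
  by_cases hx : x < N
  · have := (h.lt_iff x).2 hx
    rw [rev_apply hx, rev_apply (by omega), show N - 1 - (N - 1 - x) = x by omega]
    omega
  · rw [rev, if_neg hx, (h.fixed x).2 (by omega)]

theorem rev_idWord (n : ℕ) : rev (n + n) (idWord n) = idWord n := by
  funext x
  unfold rev idWord
  split_ifs <;> omega

theorem rev_juxt {N M : ℕ} {σ τ : ℕ → ℕ} (h : IsMatching N σ) (h' : IsMatching M τ) :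
    rev (N + M) (juxt N σ τ) = juxt M (rev M τ) (rev N σ) := by
  funext x
  by_cases hx : x < N + M
  · rw [rev_apply hx]
    by_cases hM : x < M
    · have := h'.lt_iff (M - 1 - x)
      rw [juxt, juxt, if_neg (by omega), if_pos hM, rev_apply hM,
        show N + M - 1 - x - N = M - 1 - x by omega]
      omega
    · have := h.lt_iff (N - 1 - (x - M))
      rw [juxt, juxt, if_pos (by omega), if_neg hM, rev_apply (by omega),
        show N + M - 1 - x = N - 1 - (x - M) by omega]
      omega
  · rw [rev, if_neg hx, juxt, if_neg (by omega), rev, if_neg (by omega)]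
    omega

/-- Among `N + 2` points, reflection carries the pair `i, i + 1` to `N - i + 1, N - i`; this
exchanges the roles of the two ends in `via`. -/
theorem contract_rev {N i : ℕ} {σ : ℕ → ℕ} (h : IsMatching (N + 2) σ) (hi : i ≤ N) :
    contract i (rev (N + 2) σ) = rev N (contract (N - i) σ) := by
  have hr := isMatching_rev h
  have hc := isMatching_contract (i := N - i) h (by omega)
  funext x
  by_cases hx : x < N
  · rw [← skip_inj i, skip_contract hr (by omega), rev_apply hx]
    have hs : ∀ y, y < N → skip i (N - 1 - y) = N + 1 - skip (N - i) y := by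
      intro y hy; unfold skip; split_ifs <;> omega
    have hs' : ∀ y, y < N → skip i y < N + 2 := by intro y hy; unfold skip; split_ifs <;> omega
    rw [hs _ ((hc.lt_iff _).2 (by omega)), skip_contract h (by omega)]
    have e : skip (N - i) (N - 1 - x) = N + 1 - skip i x := by
      unfold skip; split_ifs <;> omega
    rw [e]
    have l := hs' x hx
    have ne := skip_ne i x
    generalize skip i x = z at *
    unfold via
    rw [rev_apply l, rev_apply (by omega), rev_apply (by omega)]
    rw [show N + 2 - 1 - z = N + 1 - z by omega, show N + 2 - 1 - i = N - i + 1 by omega,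
      show N + 2 - 1 - (i + 1) = N - i by omega]
    have l1 := h.lt_iff (N + 1 - z)
    have l2 := h.lt_iff (N - i)
    have l3 := h.lt_iff (N - i + 1)
    have := h.inj (x := N - i) (y := N - i + 1)
    have := h.invol (N + 1 - z)
    split_ifs <;> omega
  · rw [rev, if_neg hx]
    exact ((isMatching_contract hr hi).fixed x).2 (by omega)

theorem gapColor_congr (u : Color) {i j : ℕ} (h : Even (i + j)) : gapColor u i = gapColor u j :=
  if_congr (by grind) rfl rfl

/-- The number of matched points is even, so gaps `i` and `N - i` have the same parity and hence the
same color. -/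
theorem circleFactor_rev {N i : ℕ} {σ : ℕ → ℕ} (u : Color) (h : IsMatching (N + 2) σ) (hi : i ≤ N) :
    circleFactor u i (rev (N + 2) σ) = circleFactor u (N - i) σ := by
  have ev : Even N := by have := h.even; grind
  have hl := h.lt_iff (N + 1 - i)
  have e := h.eq_iff (x := N - i) (y := N - i + 1)
  unfold circleFactor
  rw [gapColor_congr u (i := i) (j := N - i) (by rwa [show i + (N - i) = N by omega]),
    rev_apply (by omega), show N + 2 - 1 - i = N - i + 1 by omega] 
  rw [show N + 1 - i = N - i + 1 by omega] at hl
  exact if_congr (by omega) rfl rfl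

/-- Positions run around the boundary of the strip, so reflection in a horizontal line reverses
their order and exchanges bottom and top. The nested arcs being glued are symmetric under this
reversal, which makes reflection compatible with stacking. -/
theorem glue_rev {n m k : ℕ} {σ : ℕ → ℕ} (u : Color) (h : IsMatching (n + 2 * m + k) σ) :
    glue k m (rev (n + 2 * m + k) σ) = rev (n + k) (glue n m σ) ∧
      circleValue u k m (rev (n + 2 * m + k) σ) = circleValue u n m σ := by
  induction m generalizing σ with
  | zero => exact ⟨rfl, rfl⟩
  | succ m ih =>
    rw [show n + 2 * (m + 1) + k = n + 2 * m + k + 2 by omega] at h ⊢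
    have hc := isMatching_contract (i := n + m) h (by omega)
    have e : n + 2 * m + k - (k + m) = n + m := by omega
    rw [glue, glue, circleValue, circleValue, contract_rev h (by omega),
      circleFactor_rev u h (by omega), e, (ih hc).1, (ih hc).2]
    exact ⟨rfl, rfl⟩

/-! ### Cups, flips and the identity coefficient -/

/-- The diagram from `n` to `n + 2` points with a cup joining the top points `j` and `j + 1` (counted
from the left, starting at `0`) and `n` through strands. -/
def Diagram.cup (n j : ℕ) (u : Color) (hj : j ≤ n) : Diagram ⟨n, u⟩ ⟨n + 2, u⟩ where
  word := ins (n + j) 1 (idWord n)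
  isMatching := by
    have := isMatching_ins (p := n + j) (q := 1) (isMatching_idWord n) (by omega)
    rwa [show n + n + 2 * 1 = n + (n + 2) by omega] at this
  right_eq := rfl

/-- The cup diagram is the identity with an arc inserted. By `glue_ins_one` the insertion can be
postponed until after gluing, where only composition with the identity remains. -/
theorem Diagram.comp_cup {X : Obj} {n j : ℕ} {u : Color} (hj : j ≤ n) (d : Diagram X ⟨n, u⟩) :
    (d.comp (Diagram.cup n j u hj)).word = ins (X.len + j) 1 d.word ∧
      d.circles (Diagram.cup n j u hj) = 1 := by
  have hd := d.isMatching
  have hid := isMatching_idWord n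
  have hm : IsMatching (X.len + 2 * n + n) (juxt (X.len + n) d.word (idWord n)) := by
    have := isMatching_juxt hd hid
    rwa [show X.len + n + (n + n) = X.len + 2 * n + n by omega] at this
  have h1 := glue_ins_one X.right hm hj
  have h2 := glue_idWord_right hd X.right
  have e : juxt (X.len + n) d.word (ins (n + j) 1 (idWord n)) =
      ins (X.len + 2 * n + j) 1 (juxt (X.len + n) d.word (idWord n)) := by
    rw [show X.len + 2 * n + j = X.len + n + (n + j) by omega]
    exact juxt_ins_one hd
  change glue X.len n (juxt (X.len + n) d.word (ins (n + j) 1 (idWord n))) = _ ∧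
    circleValue X.right X.len n (juxt (X.len + n) d.word (ins (n + j) 1 (idWord n))) = _
  rw [e, h1.1, h1.2]
  exact ⟨by rw [h2.1], h2.2⟩

theorem Diagram.exists_comp_cup {n : ℕ} {u : Color} (d : Diagram ⟨n, u⟩ ⟨n, u⟩)
    (hd : d ≠ Diagram.id _) : ∃ (k j : ℕ) (hj : j ≤ k) (hk : k + 2 = n)
      (d' : Diagram ⟨n, u⟩ ⟨k, u⟩),
      d = d'.comp (hk ▸ Diagram.cup k j u hj) ∧ d'.circles (hk ▸ Diagram.cup k j u hj) = 1 := by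
  obtain ⟨j, hj, e⟩ := exists_top_arc d.isMatching fun h => hd (Diagram.ext h)
  simp only at hj e
  obtain ⟨k, rfl⟩ : ∃ k, n = k + 2 := ⟨n - 2, by omega⟩
  have hm := d.isMatching
  have hc := isMatching_contract (N := k + 2 + k) (i := k + 2 + j) (σ := d.word) hm (by omega)
  refine ⟨k, j, by omega, rfl, ⟨contract (k + 2 + j) d.word, hc, rfl⟩, ?_, ?_⟩
  · refine Diagram.ext ?_
    rw [(Diagram.comp_cup _ _).1]
    exact (ins_one_contract hm (by simp only; omega) e).symm
  · exact (Diagram.comp_cup _ _).2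

/-- A cup at the top of the upper diagram survives in the composite, whereas the identity has no arc
between top points. This is what makes the identity coefficient multiplicative. -/
theorem Diagram.eq_id_of_comp {n : ℕ} {u : Color} {d e : Diagram ⟨n, u⟩ ⟨n, u⟩}
    (h : d.comp e = Diagram.id _) : d = Diagram.id _ ∧ e = Diagram.id _ := by
  suffices he : e = Diagram.id _ by
    refine ⟨?_, he⟩
    rwa [he, (Diagram.comp_id d).1] at h
  by_contra hne
  obtain ⟨k, j, hj, rfl, e', he, -⟩ := e.exists_comp_cup hne
  rw [he, ← (Diagram.assoc _ _ _).1] at h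
  -- At the left foot of the cup the composite points to the next top position, while the identity
  -- points to the bottom.
  have h1 := congrArg (fun x => x.word (k + 2 + j)) h
  simp only [(Diagram.comp_cup _ _).1, ins_one_self] at h1
  simp only [Diagram.id, idWord] at h1
  split_ifs at h1 <;> omega

/-- The reflection of a diagram in a horizontal line. -/
def Diagram.flip {X Y : Obj} (d : Diagram X Y) : Diagram Y X where
  word := rev (X.len + Y.len) d.word
  isMatching := by rw [add_comm Y.len]; exact isMatching_rev d.isMatching
  right_eq := d.right_eq.symm

theorem Diagram.flip_flip {X Y : Obj} (d : Diagram X Y) : d.flip.flip = d := by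
  refine Diagram.ext ?_
  change rev (Y.len + X.len) (rev (X.len + Y.len) d.word) = _
  rw [add_comm Y.len, rev_rev d.isMatching]

theorem Diagram.flip_id (X : Obj) : (Diagram.id X).flip = Diagram.id X :=
  Diagram.ext (rev_idWord X.len)

theorem Diagram.flip_comp {X Y Z : Obj} (d : Diagram X Y) (e : Diagram Y Z) :
    (d.comp e).flip = e.flip.comp d.flip ∧ e.flip.circles d.flip = d.circles e := by
  have h := glue_rev X.right (isMatching_comp d.isMatching e.isMatching)
  have e1 : rev (X.len + 2 * Y.len + Z.len) (juxt (X.len + Y.len) d.word e.word) =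
      juxt (Z.len + Y.len) e.flip.word d.flip.word := by
    have := rev_juxt d.isMatching e.isMatching
    rw [show X.len + Y.len + (Y.len + Z.len) = X.len + 2 * Y.len + Z.len by omega] at this
    rw [this, add_comm Z.len]
    rfl
  rw [e1] at h
  refine ⟨Diagram.ext h.1.symm, ?_⟩
  change circleValue Z.right _ _ _ = circleValue X.right _ _ _
  rw [← h.2, d.right_eq, e.right_eq]

instance Diagram.instFinite (X Y : Obj) : Finite (Diagram X Y) := by
  refine Finite.of_injective (β := Fin (X.len + Y.len) → Fin (X.len + Y.len))
    (fun d x => ⟨d.word x, (d.isMatching.lt_iff _).2 x.2⟩) fun d e h => Diagram.ext ?_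
  funext x
  by_cases hx : x < X.len + Y.len
  · exact congrArg Fin.val (congrFun h ⟨x, hx⟩)
  · rw [(d.isMatching.fixed x).2 (by omega), (e.isMatching.fixed x).2 (by omega)]

/-! ### Linear structure, the identity coefficient, and endomorphisms killing lower objects -/

section Category

variable {R : Type*} [CommRing R] {φ : BaseRing →+* R}

variable (φ) in
theorem smul_homComp {X Y Z : Obj} (r : R) (f : Diagram X Y →₀ R) (g : Diagram Y Z →₀ R) :
    homComp φ (r • f) g = r • homComp φ f g := by
  induction f using Finsupp.induction_linear with
  | zero => simp only [zero_homComp, smul_zero]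
  | add f f' hf hf' => rw [smul_add, add_homComp, add_homComp, hf, hf', smul_add]
  | single d a =>
    induction g using Finsupp.induction_linear with
    | zero => simp only [homComp_zero, smul_zero]
    | add g g' hg hg' => rw [homComp_add, homComp_add, hg, hg', smul_add]
    | single e b => simp only [Finsupp.smul_single, smul_eq_mul, homComp_single, mul_assoc]

variable (φ) in
theorem homComp_smul {X Y Z : Obj} (r : R) (f : Diagram X Y →₀ R) (g : Diagram Y Z →₀ R) :
    homComp φ f (r • g) = r • homComp φ f g := by
  induction f using Finsupp.induction_linear with
  | zero => simp only [zero_homComp, smul_zero]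
  | add f f' hf hf' => rw [add_homComp, add_homComp, hf, hf', smul_add]
  | single d a =>
    induction g using Finsupp.induction_linear with
    | zero => simp only [homComp_zero, smul_zero]
    | add g g' hg hg' => rw [smul_add, homComp_add, homComp_add, hg, hg', smul_add]
    | single e b =>
      simp only [Finsupp.smul_single, smul_eq_mul, homComp_single]
      congr 1
      ring

noncomputable instance instLinear : Linear R (TL φ) where
  homModule X Y := inferInstanceAs (Module R (Diagram X.obj Y.obj →₀ R))
  smul_comp _ _ _ r f g := smul_homComp φ r f g
  comp_smul _ _ _ f r g := homComp_smul φ r f g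

variable (φ) in
/-- The morphism given by a diagram. -/
noncomputable def ofDiagram {X Y : TL φ} (d : Diagram X.obj Y.obj) : X ⟶ Y :=
  (Finsupp.single d 1 : Diagram X.obj Y.obj →₀ R)

theorem ofDiagram_comp {X Y Z : TL φ} (d : Diagram X.obj Y.obj) (e : Diagram Y.obj Z.obj) :
    ofDiagram φ d ≫ ofDiagram φ e = φ (d.circles e) • ofDiagram φ (d.comp e) := by
  change homComp φ (Finsupp.single d 1) (Finsupp.single e 1) =
    φ (d.circles e) • (Finsupp.single (d.comp e) 1 : Diagram X.obj Z.obj →₀ R)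
  rw [homComp_single, Finsupp.smul_single]
  simp

theorem ofDiagram_id (X : TL φ) : ofDiagram φ (Diagram.id X.obj) = 𝟙 X := rfl

/-- Linear induction: morphisms are generated by diagrams. -/
@[elab_as_elim]
theorem hom_induction {X Y : TL φ} {p : (X ⟶ Y) → Prop} (f : X ⟶ Y) (zero : p 0)
    (add : ∀ f g, p f → p g → p (f + g)) (smul : ∀ (r : R) d, p (r • ofDiagram φ d)) : p f := by
  refine Finsupp.induction_linear (motive := p) f zero add fun d a => ?_
  have := smul a d
  rwa [show a • ofDiagram φ d = (Finsupp.single d a : Diagram X.obj Y.obj →₀ R) from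
    (Finsupp.smul_single a d 1).trans (by simp)] at this

/-- The coefficients of a morphism, as a linear equivalence. -/
noncomputable def homEquiv (X Y : TL φ) : (X ⟶ Y) ≃ₗ[R] (Diagram X.obj Y.obj →₀ R) :=
  LinearEquiv.refl R (Diagram X.obj Y.obj →₀ R)

instance (X Y : TL φ) : Module.Finite R (X ⟶ Y) := Module.Finite.equiv (homEquiv X Y).symm

instance (X Y : TL φ) : Module.Free R (X ⟶ Y) := Module.Free.of_equiv (homEquiv X Y).symm

/-- The coefficient of the identity matching. -/
noncomputable def idCoeff (X : TL φ) : End X →ₗ[R] R :=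
  (Finsupp.lapply (Diagram.id X.obj)).comp (homEquiv X X).toLinearMap

theorem coeff_id_eq_idCoeff {X : TL φ} (f : End X) :
    coeff (X := X) (Y := X) f (Diagram.id X.obj) = idCoeff X f := rfl

open Classical in
theorem idCoeff_ofDiagram {X : TL φ} (d : Diagram X.obj X.obj) :
    idCoeff X (ofDiagram φ d) = if d = Diagram.id X.obj then 1 else 0 :=
  Finsupp.single_apply

theorem idCoeff_one (X : TL φ) : idCoeff X 1 = 1 := by
  classical exact (idCoeff_ofDiagram _).trans (if_pos rfl)

/-- By bilinearity it suffices to consider matchings, where `Diagram.eq_id_of_comp` leaves only the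
pair of identities, which closes no circle. -/
theorem idCoeff_comp {X : TL φ} (f g : X ⟶ X) :
    idCoeff X (f ≫ g) = idCoeff X f * idCoeff X g := by
  classical
  obtain ⟨⟨n, u⟩⟩ := X
  refine hom_induction f ?_ (fun f f' hf hf' => ?_) fun r d => ?_
  · rw [Limits.zero_comp, map_zero, zero_mul]
  · rw [Preadditive.add_comp, map_add, map_add, hf, hf', add_mul]
  refine hom_induction g ?_ (fun g g' hg hg' => ?_) fun s e => ?_
  · rw [Limits.comp_zero, map_zero, mul_zero]
  · rw [Preadditive.comp_add, map_add, map_add, hg, hg', mul_add]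
  rw [Linear.smul_comp, Linear.comp_smul, ofDiagram_comp]
  simp only [map_smul, idCoeff_ofDiagram, smul_eq_mul]
  by_cases h : d = Diagram.id _ ∧ e = Diagram.id _
  · obtain ⟨rfl, rfl⟩ := h
    rw [(Diagram.comp_id _).1, (Diagram.comp_id _).2]
    simp
  · rw [if_neg fun h' => h (Diagram.eq_id_of_comp h')]
    rw [not_and_or] at h
    rcases h with h | h <;> simp [h]

theorem idCoeff_mul {X : TL φ} (f g : End X) : idCoeff X (f * g) = idCoeff X f * idCoeff X g := by
  rw [End.mul_def, idCoeff_comp, mul_comm]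

/-- `e ∘ g = 0` for all `g` from objects with fewer points. -/
def KillsLower {n : ℕ} {u : Color} (e : End (ob φ n u)) : Prop :=
  ∀ k < n, ∀ g : ob φ k u ⟶ ob φ n u, g ≫ e = 0

/-- A nonidentity matching factors through `n - 2` points, with coefficient `1` because no circle is
closed. -/
theorem KillsLower.ofDiagram_comp {n : ℕ} {u : Color} {e : End (ob φ n u)} (he : KillsLower e)
    {d : Diagram ⟨n, u⟩ ⟨n, u⟩} (hd : d ≠ Diagram.id _) :
    (ofDiagram φ d : ob φ n u ⟶ ob φ n u) ≫ e = 0 := by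
  obtain ⟨k, j, hj, rfl, d', h1, h2⟩ := d.exists_comp_cup hd
  have := TwoColorTL.ofDiagram_comp (φ := φ) (X := ob φ (k + 2) u) (Y := ob φ k u)
    (Z := ob φ (k + 2) u) d' (Diagram.cup k j u hj)
  simp only at h1 h2
  rw [h2, map_one, one_smul, ← h1] at this
  rw [← this, Category.assoc, he k (by omega), Limits.comp_zero]

/-- Only the identity term of `w` survives composition with `e`. Note that `e * w` is `w ≫ e`, with
`w` applied first. -/
theorem KillsLower.mul_eq {n : ℕ} {u : Color} {e : End (ob φ n u)} (he : KillsLower e)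
    (w : End (ob φ n u)) : e * w = idCoeff (ob φ n u) w • e := by
  classical
  rw [End.mul_def]
  refine hom_induction (p := fun w => w ≫ e = idCoeff _ w • e) w ?_ (fun f f' hf hf' => ?_)
    fun r d => ?_
  · rw [Limits.zero_comp, map_zero, zero_smul]
  · rw [Preadditive.add_comp, hf, hf', map_add, add_smul]
  · rw [map_smul, idCoeff_ofDiagram, Linear.smul_comp]
    by_cases hd : d = Diagram.id _
    · rw [if_pos hd, hd, ofDiagram_id, Category.id_comp, smul_eq_mul, mul_one]
    · rw [if_neg hd, he.ofDiagram_comp hd]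
      simp

/-- Reflection in a horizontal line, extended linearly. -/
noncomputable def flipHom (X Y : TL φ) : (X ⟶ Y) →ₗ[R] (Y ⟶ X) :=
  (homEquiv Y X).symm.toLinearMap.comp
    ((Finsupp.lmapDomain R R Diagram.flip).comp (homEquiv X Y).toLinearMap)

theorem flipHom_ofDiagram {X Y : TL φ} (d : Diagram X.obj Y.obj) :
    flipHom X Y (ofDiagram φ d) = ofDiagram φ d.flip :=
  Finsupp.mapDomain_single

theorem flipHom_comp {X Y Z : TL φ} (f : X ⟶ Y) (g : Y ⟶ Z) :
    flipHom X Z (f ≫ g) = flipHom Y Z g ≫ flipHom X Y f := by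
  refine hom_induction f ?_ (fun f f' hf hf' => ?_) fun r d => ?_
  · simp
  · rw [Preadditive.add_comp, map_add, map_add, hf, hf', Preadditive.comp_add]
  refine hom_induction g ?_ (fun g g' hg hg' => ?_) fun s e => ?_
  · simp
  · rw [Preadditive.comp_add, map_add, map_add, hg, hg', Preadditive.add_comp]
  simp only [Linear.smul_comp, Linear.comp_smul, ofDiagram_comp, map_smul, flipHom_ofDiagram,
    (Diagram.flip_comp _ _).1, (Diagram.flip_comp _ _).2]
  rw [smul_comm r s]

theorem flipHom_flipHom {X Y : TL φ} (f : X ⟶ Y) : flipHom Y X (flipHom X Y f) = f := by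
  refine hom_induction f ?_ (fun f f' hf hf' => ?_) fun r d => ?_
  · simp
  · rw [map_add, map_add, hf, hf']
  · rw [map_smul, map_smul, flipHom_ofDiagram, flipHom_ofDiagram, Diagram.flip_flip]

theorem idCoeff_flipHom {X : TL φ} (f : End X) : idCoeff X (flipHom X X f) = idCoeff X f := by
  classical
  refine hom_induction (p := fun f => idCoeff X (flipHom X X f) = idCoeff X f) f ?_
    (fun f f' hf hf' => ?_) fun r d => ?_
  · simp
  · rw [map_add, map_add, map_add, hf, hf']
  · rw [map_smul, map_smul, map_smul, flipHom_ofDiagram, idCoeff_ofDiagram, idCoeff_ofDiagram]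
    congr 1
    refine if_congr ⟨fun h => ?_, fun h => ?_⟩ rfl rfl
    · rw [← d.flip_flip, h, Diagram.flip_id]
    · rw [h, Diagram.flip_id]

theorem KillsLower.comp_flipHom {n : ℕ} {u : Color} {e : End (ob φ n u)} (he : KillsLower e)
    (w : End (ob φ n u)) :
    flipHom (ob φ n u) (ob φ n u) e ≫ w = idCoeff _ w • flipHom (ob φ n u) (ob φ n u) e := by
  have := congrArg (flipHom (ob φ n u) (ob φ n u)) (he.mul_eq (flipHom (ob φ n u) (ob φ n u) w))
  rwa [End.mul_def, flipHom_comp, flipHom_flipHom, idCoeff_flipHom, map_smul] at this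

/-- The projector with identity coefficient `1` which kills the morphisms from smaller objects is
unique. -/
theorem KillsLower.unique {n : ℕ} {u : Color} {e e' : End (ob φ n u)} (he : KillsLower e)
    (he' : KillsLower e') (h : idCoeff _ e = 1) (h' : idCoeff _ e' = 1) : e = e' := by
  -- The composite `flipHom e' ≫ e'` equals `e'` by the killing property and `flipHom e'` by its
  -- mirror image. Hence `e'` also absorbs from the other side, and `e' ≫ e` equals both `e` and
  -- `e'`.
  have hflip : flipHom (ob φ n u) (ob φ n u) e' = e' := by
    have h1 := he'.mul_eq (flipHom (ob φ n u) (ob φ n u) e')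
    have h2 := he'.comp_flipHom e'
    rw [End.mul_def, idCoeff_flipHom, h', one_smul] at h1
    rw [h', one_smul] at h2
    exact h2.symm.trans h1
  have h1 := he.mul_eq e'
  have h2 := he'.comp_flipHom e
  rw [hflip, h, one_smul] at h2
  rw [End.mul_def, h', one_smul] at h1
  exact h1.symm.trans h2

end Category

/-! ### Decompositions into indecomposable idempotents -/

section Decomposition

variable {S E : Type*} [CommRing S] [IsDomain S] [Ring E] [Algebra S E]

/-- Multiplying a relation by `f i` isolates its `i`-th term. The rank therefore bounds the number
of nonzero orthogonal idempotents, so repeated splitting must stop. -/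
theorem linearIndependent_of_orthogonalIdempotents [Module.IsTorsionFree S E] {ι : Type*}
    {f : ι → E} (hf : OrthogonalIdempotents f) (h0 : ∀ i, f i ≠ 0) : LinearIndependent S f := by
  rw [linearIndependent_iff']
  intro s g hg i hi
  have h := congrArg (· * f i) hg
  simp only [Finset.sum_mul, zero_mul] at h
  rw [Finset.sum_eq_single i (fun j _ hj => by rw [smul_mul_assoc, hf.ortho hj, smul_zero])
    (fun h' => (h' hi).elim), smul_mul_assoc, (hf.idem i).eq] at h
  exact (smul_eq_zero.1 h).resolve_right (h0 i)

end Decomposition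

/-- Splitting one member of a complete family of orthogonal idempotents. -/
theorem _root_.CompleteOrthogonalIdempotents.split {E : Type*} [Ring E] {d : ℕ} {f : Fin d → E}
    (hf : CompleteOrthogonalIdempotents f) {j : Fin d} {a b : E} (ha : IsIdempotentElem a)
    (hb : IsIdempotentElem b) (hab : a * b = 0) (hba : b * a = 0) (h : a + b = f j) :
    CompleteOrthogonalIdempotents (Fin.cons a (Function.update f j b) : Fin (d + 1) → E) := by
  have haj : a * f j = a := by rw [← h, mul_add, ha.eq, hab, add_zero]
  have hja : f j * a = a := by rw [← h, add_mul, ha.eq, hba, add_zero]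
  have hbj : b * f j = b := by rw [← h, mul_add, hb.eq, hba, zero_add]
  have hjb : f j * b = b := by rw [← h, add_mul, hb.eq, hab, zero_add]
  have ak : ∀ k, k ≠ j → a * f k = 0 := fun k hk => by
    rw [← haj, mul_assoc, hf.ortho hk.symm, mul_zero]
  have ka : ∀ k, k ≠ j → f k * a = 0 := fun k hk => by
    rw [← hja, ← mul_assoc, hf.ortho hk, zero_mul]
  have bk : ∀ k, k ≠ j → b * f k = 0 := fun k hk => by
    rw [← hbj, mul_assoc, hf.ortho hk.symm, mul_zero]
  have kb : ∀ k, k ≠ j → f k * b = 0 := fun k hk => by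
    rw [← hjb, ← mul_assoc, hf.ortho hk, zero_mul]
  refine ⟨⟨fun i => ?_, fun i k hik => ?_⟩, ?_⟩
  · refine Fin.cases ha (fun i => ?_) i
    rw [Fin.cons_succ]
    by_cases hi : i = j
    · rw [hi, Function.update_self]; exact hb
    · rw [Function.update_of_ne hi]; exact hf.idem i
  · induction i using Fin.cases with
    | zero =>
      induction k using Fin.cases with
      | zero => exact (hik rfl).elim
      | succ k =>
        change a * Function.update f j b k = 0
        by_cases hk : k = j
        · rw [hk, Function.update_self, hab]
        · rw [Function.update_of_ne hk, ak k hk]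
    | succ i =>
      induction k using Fin.cases with
      | zero =>
        change Function.update f j b i * a = 0
        by_cases hi : i = j
        · rw [hi, Function.update_self, hba]
        · rw [Function.update_of_ne hi, ka i hi]
      | succ k =>
        have hne : i ≠ k := fun h => hik (by rw [h])
        change Function.update f j b i * Function.update f j b k = 0
        by_cases hi : i = j
        · subst hi
          rw [Function.update_self, Function.update_of_ne hne.symm, bk k hne.symm]
        · by_cases hk : k = j
          · subst hk
            rw [Function.update_self, Function.update_of_ne hi, kb i hi]
          · rw [Function.update_of_ne hi, Function.update_of_ne hk, hf.ortho hne]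
  · rw [Fin.sum_univ_succ]
    simp only [Fin.cons_zero, Fin.cons_succ]
    rw [Finset.sum_update_of_mem (Finset.mem_univ j), ← add_assoc, h,
      Finset.sdiff_singleton_eq_erase, Finset.add_sum_erase _ _ (Finset.mem_univ j), hf.complete]

/-- In a finite torsion free algebra over a domain, every indecomposable idempotent occurs in a
decomposition of `1` into indecomposable orthogonal idempotents. -/
theorem IsIndecomposableIdempotent.exists_decomposition (S : Type*) {E : Type*} [CommRing S]
    [IsDomain S] [Ring E] [Algebra S E] [Module.Finite S E] [Module.IsTorsionFree S E] {e : E}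
    (he : IsIndecomposableIdempotent e) :
    ∃ (d : ℕ) (f : Fin d → E), CompleteOrthogonalIdempotents f ∧
      (∀ i, IsIndecomposableIdempotent (f i)) ∧ ∃ i, f i = e := by
  by_contra! hno
  -- If no decomposition works, splitting never ends: a complete family containing `e` always has a
  -- decomposable member, necessarily different from `e`, so `e` survives each split. The start is
  -- `1` alone or `e, 1 - e`. A family larger than the rank is the contradiction.
  have step : ∀ m : ℕ, ∃ d ≥ m, ∃ f : Fin d → E, CompleteOrthogonalIdempotents f ∧
      (∀ i, f i ≠ 0) ∧ ∃ i, f i = e := by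
    intro m
    induction m with
    | zero =>
      have h1 : CompleteOrthogonalIdempotents (fun _ : Fin 1 => (1 : E)) :=
        ⟨⟨fun _ => IsIdempotentElem.one, fun i j h => (h (Subsingleton.elim _ _)).elim⟩, by simp⟩
      by_cases he1 : e = 1
      · exact ⟨1, by omega, _, h1, fun _ => he1 ▸ he.ne_zero, 0, he1.symm⟩
      · refine ⟨2, by omega, _, h1.split (j := 0) he.idem he.idem.one_sub ?_ ?_ (by simp),
          fun i => ?_, 0, rfl⟩
        · rw [mul_sub, mul_one, he.idem.eq, sub_self]
        · rw [sub_mul, one_mul, he.idem.eq, sub_self]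
        · refine Fin.cases he.ne_zero (fun i => ?_) i
          rw [Fin.cons_succ, Subsingleton.elim i 0, Function.update_self]
          exact sub_ne_zero.2 (Ne.symm he1)
    | succ m ih =>
      obtain ⟨d, hd, f, hf, h0, i, rfl⟩ := ih
      obtain ⟨j, hj⟩ : ∃ j, ¬ IsIndecomposableIdempotent (f j) := by
        by_contra! hall
        exact hno d f hf hall i rfl
      obtain ⟨a, b, ha, hb, hab, hba, h, ha0, hb0⟩ : ∃ a b : E, IsIdempotentElem a ∧
          IsIdempotentElem b ∧ a * b = 0 ∧ b * a = 0 ∧ a + b = f j ∧ a ≠ 0 ∧ b ≠ 0 := by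
        by_contra! hall
        exact hj ⟨hf.idem j, h0 j, fun a b ha hb hab hba h =>
          or_iff_not_imp_left.2 (hall a b ha hb hab hba h)⟩
      have hij : i ≠ j := fun h => hj (h ▸ he)
      refine ⟨d + 1, by omega, _, hf.split ha hb hab hba h, fun k => ?_, i.succ, ?_⟩
      · refine Fin.cases ha0 (fun k => ?_) k
        rw [Fin.cons_succ]
        by_cases hk : k = j
        · rw [hk, Function.update_self]; exact hb0
        · rw [Function.update_of_ne hk]; exact h0 k
      · rw [Fin.cons_succ, Function.update_of_ne hij]
  obtain ⟨d, hd, f, hf, h0, -⟩ := step (Module.finrank S E + 1)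
  have := (linearIndependent_of_orthogonalIdempotents (S := S)
    hf.toOrthogonalIdempotents h0).fintype_card_le_finrank
  rw [Fintype.card_fin] at this
  omega

/-! ### Characterization of Jones-Wenzl projectors -/

section Domain

variable {R : Type*} [CommRing R] {φ : BaseRing →+* R}

theorem KillsLower.isIdempotentElem {n : ℕ} {u : Color} {e : End (ob φ n u)} (he : KillsLower e)
    (h : idCoeff _ e = 1) : IsIdempotentElem e := by
  rw [IsIdempotentElem, he.mul_eq, h, one_smul]

instance (X : TL φ) : Module.Finite R (End X) := inferInstanceAs (Module.Finite R (X ⟶ X))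

instance (X : TL φ) : Module.Free R (End X) := inferInstanceAs (Module.Free R (X ⟶ X))

variable [IsDomain R]

/-- If `e = a + b` orthogonally, then `a = e * a = ε(a) • e`, and likewise for `b`. From `ε(a) ε(b)
= 0` in a domain, one summand vanishes. -/
theorem KillsLower.isIndecomposableIdempotent {n : ℕ} {u : Color} {e : End (ob φ n u)}
    (he : KillsLower e) (h : idCoeff _ e = 1) : IsIndecomposableIdempotent e := by
  refine ⟨he.isIdempotentElem h, fun h0 => ?_, fun a b ha hb hab hba hsum => ?_⟩
  · rw [h0, map_zero] at h
    exact zero_ne_one h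
  · have hea : e * a = a := by rw [← hsum, add_mul, ha.eq, hba, add_zero]
    have heb : e * b = b := by rw [← hsum, add_mul, hb.eq, hab, zero_add]
    have h0 := congrArg (idCoeff _) hab
    rw [idCoeff_mul, map_zero, mul_eq_zero] at h0
    rw [he.mul_eq] at hea heb
    rcases h0 with h0 | h0
    · exact .inl (by rw [← hea, h0, zero_smul])
    · exact .inr (by rw [← heb, h0, zero_smul])

/-- The identity coefficient of an idempotent is an idempotent scalar, so over a domain a nonzero
one equals `1`. Conversely, the two conditions on the right already force an indecomposable
idempotent, which extends to a decomposition of `1`. -/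
theorem isJonesWenzl_iff {n : ℕ} {u : Color} {e : End (ob φ n u)} :
    IsJonesWenzl e ↔ idCoeff _ e = 1 ∧ KillsLower e := by
  constructor
  · rintro ⟨⟨⟨d, f, hf, -, i, rfl⟩, h0⟩, hk⟩
    have h := congrArg (idCoeff _) (hf.idem i).eq
    rw [idCoeff_mul] at h
    exact ⟨mul_left_cancel₀ h0 (by rw [coeff_id_eq_idCoeff, h, mul_one]), hk⟩
  · rintro ⟨h, hk⟩
    refine ⟨⟨(hk.isIndecomposableIdempotent h).exists_decomposition R, ?_⟩, hk⟩
    rw [coeff_id_eq_idCoeff, h]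
    exact one_ne_zero

theorem IsJonesWenzl.unique {n : ℕ} {u : Color} {e e' : End (ob φ n u)} (he : IsJonesWenzl e)
    (he' : IsJonesWenzl e') : e = e' := by
  rw [isJonesWenzl_iff] at he he'
  exact he.2.unique he'.2 he.1 he'.1

end Domain

/-! ### Extension of scalars -/

section BaseChange

variable {S R : Type*} [CommRing S] [CommRing R] {φ : BaseRing →+* S} {φ' : BaseRing →+* R}
  (ψ : S →+* R)

/-- Extension of scalars on a morphism space, as a semilinear map. -/
noncomputable def extend (φ : BaseRing →+* S) (φ' : BaseRing →+* R) (ψ : S →+* R) (X Y : Obj) :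
    ((⟨X⟩ : TL φ) ⟶ ⟨Y⟩) →ₛₗ[ψ] ((⟨X⟩ : TL φ') ⟶ ⟨Y⟩) where
  toFun f := Finsupp.mapRange ψ ψ.map_zero (show Diagram X Y →₀ S from f)
  map_add' f g := Finsupp.mapRange_add (map_add ψ) f g
  map_smul' r f := Finsupp.mapRange_smul' r (ψ r) f fun a => map_mul ψ r a

theorem extend_ofDiagram {X Y : Obj} (d : Diagram X Y) :
    extend φ φ' ψ X Y (ofDiagram φ d) = ofDiagram φ' d := by
  change Finsupp.mapRange ψ ψ.map_zero (Finsupp.single d 1) = Finsupp.single d 1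
  rw [Finsupp.mapRange_single, map_one]

theorem extend_surjective (hs : Function.Surjective ψ) (X Y : Obj) :
    Function.Surjective (extend φ φ' ψ X Y) :=
  Finsupp.mapRange_surjective ψ ψ.map_zero hs

theorem idCoeff_extend {X : Obj} (f : End (⟨X⟩ : TL φ)) :
    idCoeff _ (extend φ φ' ψ X X f) = ψ (idCoeff _ f) := rfl

variable {ψ}

theorem extend_comp (hψ : ψ.comp φ = φ') {X Y Z : Obj} (f : (⟨X⟩ : TL φ) ⟶ ⟨Y⟩)
    (g : (⟨Y⟩ : TL φ) ⟶ ⟨Z⟩) :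
    extend φ φ' ψ X Z (f ≫ g) = extend φ φ' ψ X Y f ≫ extend φ φ' ψ Y Z g :=
  (baseChange ψ hψ).map_comp f g

/-- Killing lower morphisms is preserved by extension of scalars. -/
theorem KillsLower.extend (hψ : ψ.comp φ = φ') {n : ℕ} {u : Color} {e : End (ob φ n u)}
    (he : KillsLower e) : KillsLower (n := n) (u := u) (extend φ φ' ψ _ _ e) := by
  intro k hk g
  induction g using hom_induction with
  | zero => exact Limits.zero_comp
  | add f g hf hg => rw [Preadditive.add_comp, hf, hg, add_zero]
  -- Morphism spaces over both rings are spanned by the same matchings, so it suffices to test `g`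
  -- already defined over `S`.
  | smul r d =>
    rw [Linear.smul_comp, ← extend_ofDiagram (φ := φ) ψ d, ← extend_comp hψ, he k hk, map_zero,
      smul_zero]

/-- An endomorphism of a morphism space which becomes the identity along a local homomorphism is
bijective. -/
theorem bijective_of_extend_eq [IsLocalHom ψ] {X Y : Obj}
    (T : ((⟨X⟩ : TL φ) ⟶ ⟨Y⟩) →ₗ[S] ((⟨X⟩ : TL φ) ⟶ ⟨Y⟩))
    (hT : ∀ w, extend φ φ' ψ X Y (T w) = extend φ φ' ψ X Y w) : Function.Bijective T := by
  classical
  have := Fintype.ofFinite (Diagram X Y)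
  let b : Module.Basis (Diagram X Y) S ((⟨X⟩ : TL φ) ⟶ ⟨Y⟩) := ⟨homEquiv (φ := φ) ⟨X⟩ ⟨Y⟩⟩
  -- In the basis of matchings the matrix of `T` reduces to the identity matrix, so its determinant
  -- maps to `1` and is a unit by locality.
  have hmat : (LinearMap.toMatrix b b T).map ψ = 1 := by
    ext d e
    have hb : b e = ofDiagram φ e := rfl
    have h := congrArg (fun f => coeff f d) (hT (b e))
    rw [Matrix.map_apply, LinearMap.toMatrix_apply]
    refine h.trans ?_
    rw [hb, extend_ofDiagram]
    change (Finsupp.single e 1 : Diagram X Y →₀ R) d = _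
    rw [Finsupp.single_apply, Matrix.one_apply]
    exact if_congr eq_comm rfl rfl
  have hdet : ψ (LinearMap.toMatrix b b T).det = 1 := by
    rw [RingHom.map_det, RingHom.mapMatrix_apply, hmat, Matrix.det_one]
  have hu : IsUnit (LinearMap.toMatrix b b T).det :=
    isUnit_of_map_unit ψ _ (by rw [hdet]; exact isUnit_one)
  exact (LinearEquiv.ofIsUnitDet (f := T) (v := b) (v' := b) hu).bijective

/-- Projectors lift along surjective local homomorphisms. -/
theorem KillsLower.exists_lift [IsLocalHom ψ] (hψ : ψ.comp φ = φ') (hs : Function.Surjective ψ)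
    {n : ℕ} {u : Color} {e : End (ob φ' n u)} (he : KillsLower e) (h1 : idCoeff _ e = 1) :
    ∃ e' : End (ob φ n u), KillsLower e' ∧ idCoeff _ e' = 1 ∧
      TwoColorTL.extend φ φ' ψ _ _ e' = e := by
  obtain ⟨f, hf⟩ : ∃ f : ob φ n u ⟶ ob φ n u, TwoColorTL.extend φ φ' ψ _ _ f = e :=
    extend_surjective ψ hs _ _ e
  -- `y` lifts `1 - e` and has no identity coefficient
  let ε : (ob φ n u ⟶ ob φ n u) →ₗ[S] S := idCoeff (ob φ n u)
  have hε1 : ε (𝟙 _) = 1 := idCoeff_one _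
  let y : ob φ n u ⟶ ob φ n u := 𝟙 _ - f - ε (𝟙 _ - f) • 𝟙 _
  have hεy : ε y = 0 := by
    rw [map_sub, map_smul, hε1, smul_eq_mul, mul_one, sub_self]
  have hone : TwoColorTL.extend φ φ' ψ ⟨n, u⟩ ⟨n, u⟩ (𝟙 (ob φ n u)) = 𝟙 _ :=
    extend_ofDiagram ψ (Diagram.id ⟨n, u⟩)
  -- The scalar subtracted to get `ε y = 0` reduces to `1 - ε(e) = 0`, so the correction does not
  -- change the reduction of `y`.
  have hψε : ψ (ε (𝟙 _ - f)) = 0 := by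
    have : ψ (ε f) = 1 := by rw [← h1, ← hf]; rfl
    rw [map_sub, map_sub, this, hε1, map_one, sub_self]
  have hy : TwoColorTL.extend φ φ' ψ ⟨n, u⟩ ⟨n, u⟩ y = 𝟙 _ - e := by
    simp only [y]
    rw [map_sub, map_sub, map_smulₛₗ, hψε, zero_smul, sub_zero, hone, hf]
  -- post-composition with `y` is injective on lower morphisms
  have hinj : ∀ k < n, ∀ g : ob φ k u ⟶ ob φ n u, g ≫ y = 0 → g = 0 := by
    intro k hk g hg
    -- After reduction, post-composition with `y` becomes post-composition with `1 - e`, which fixes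
    -- every lower morphism because `e` kills it.
    refine (bijective_of_extend_eq (φ' := φ') (ψ := ψ)
      (Linear.rightComp S (ob φ k u) (Y := ob φ n u) (Z := ob φ n u) y) fun w => ?_).1 ?_
    · rw [Linear.rightComp_apply, extend_comp hψ, hy, Preadditive.comp_sub, Category.comp_id,
        he k hk, sub_zero]
    · rw [map_zero]; exact hg
  -- On all of `End(n_u)`, `w ≫ (1 - e)` differs from `w` by `ε(w) • e`. The added term `ε(w) • (1 -
  -- y)` reduces to exactly this, so the operator becomes the identity and `y` has a preimage `x`.
  obtain ⟨x, hx⟩ := (bijective_of_extend_eq (φ' := φ') (ψ := ψ)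
    (Linear.rightComp S (ob φ n u) (Y := ob φ n u) (Z := ob φ n u) y +
      (LinearMap.toSpanSingleton S (ob φ n u ⟶ ob φ n u) (𝟙 _ - y)).comp ε) fun w => by
    have hw := he.mul_eq (TwoColorTL.extend φ φ' ψ _ _ w)
    rw [End.mul_def, idCoeff_extend] at hw
    rw [LinearMap.add_apply, Linear.rightComp_apply, map_add, extend_comp hψ, hy,
      Preadditive.comp_sub, Category.comp_id, hw, LinearMap.comp_apply,
      LinearMap.toSpanSingleton_apply, map_smulₛₗ, map_sub, hone, hy, sub_sub_cancel,
      sub_add_cancel]).2 y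
  rw [LinearMap.add_apply, Linear.rightComp_apply, LinearMap.comp_apply,
    LinearMap.toSpanSingleton_apply] at hx
  -- Applying `ε` to the equation for `x` gives `ε(x) = ε(y) = 0`, since `ε(x ≫ y) = 0` and `ε(1 -
  -- y) = 1`. The correction disappears, leaving `x ≫ y = y`.
  have hεx : ε x = 0 := by
    have h := congrArg ε hx
    have h2 : ε (x ≫ y) = 0 := by rw [idCoeff_comp, show idCoeff _ y = 0 from hεy, mul_zero]
    rw [map_add, h2, map_smul, map_sub, hεy, hε1, zero_add, sub_zero, smul_eq_mul,
      mul_one] at h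
    exact h
  rw [hεx, zero_smul, add_zero] at hx
  -- The lift is `1 - x`: for lower `g`, composing `g ≫ (1 - x)` with `y` gives `0`, so injectivity
  -- applies. Its reduction is `e`, because `x ≫ y = y` reduces to `x = 1 - e` once the reduction of
  -- `x` is killed by `e`.
  refine ⟨𝟙 _ - x, fun k hk g => hinj k hk _ ?_, ?_, ?_⟩
  · rw [Category.assoc, Preadditive.sub_comp, Category.id_comp, hx, sub_self, Limits.comp_zero]
  · rw [map_sub, hεx, sub_zero, hε1]
  · have h2 := congrArg (TwoColorTL.extend φ φ' ψ ⟨n, u⟩ ⟨n, u⟩) hx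
    have hw := he.mul_eq (TwoColorTL.extend φ φ' ψ _ _ x)
    rw [End.mul_def, idCoeff_extend, hεx, map_zero, zero_smul] at hw
    rw [extend_comp hψ, hy, Preadditive.comp_sub, Category.comp_id, hw, sub_zero] at h2
    rw [map_sub, h2]
    exact (congrArg (· - _) hone).trans (sub_sub_cancel _ _)

end BaseChange

/-! ### Specialization of power series and the theorem -/

instance {σ 𝕜 : Type*} [CommRing 𝕜] :
    IsLocalHom (MvPowerSeries.constantCoeff (σ := σ) (R := 𝕜)) :=
  ⟨fun _ h => MvPowerSeries.isUnit_iff_constantCoeff.2 h⟩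

theorem constantCoeff_surjective (σ 𝕜 : Type*) [CommRing 𝕜] :
    Function.Surjective (MvPowerSeries.constantCoeff (σ := σ) (R := 𝕜)) :=
  fun a => ⟨MvPowerSeries.C a, MvPowerSeries.constantCoeff_C a⟩

end TwoColorTL

theorem theorem6p5 {𝕜 : Type*} [CommRing 𝕜] [IsDomain 𝕜] [HenselianLocalRing 𝕜]
    [Algebra TwoColorTL.BaseRing 𝕜]
    {Q : Type*} [Field Q] [Algebra (MvPowerSeries TwoColorTL.Color 𝕜) Q]
    [IsFractionRing (MvPowerSeries TwoColorTL.Color 𝕜) Q]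
    (n : ℕ) (u : TwoColorTL.Color)
    (jw : End (TwoColorTL.ob (algebraMap TwoColorTL.BaseRing 𝕜) n u))
    (hjw : TwoColorTL.IsJonesWenzl jw) :
    ∃ (jwHat : End (TwoColorTL.ob (TwoColorTL.deformation 𝕜) n u))
      (jwGen : End (TwoColorTL.ob
        ((algebraMap (MvPowerSeries TwoColorTL.Color 𝕜) Q).comp (TwoColorTL.deformation 𝕜)) n u)),
      -- the Jones-Wenzl projectors over the power series ring and over its fraction field
      (TwoColorTL.IsJonesWenzl jwHat ∧ ∀ e, TwoColorTL.IsJonesWenzl e → e = jwHat) ∧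
      (TwoColorTL.IsJonesWenzl jwGen ∧ ∀ e, TwoColorTL.IsJonesWenzl e → e = jwGen) ∧
      -- lifting and specialization
      (TwoColorTL.specialization 𝕜).map jwHat = jw ∧
      (TwoColorTL.generic 𝕜 Q).map jwHat = jwGen ∧
      -- the coefficients agree
      ∀ d : TwoColorTL.Diagram ⟨n, u⟩ ⟨n, u⟩,
        MvPowerSeries.constantCoeff (TwoColorTL.coeff jwHat d) = TwoColorTL.coeff jw d ∧
        algebraMap (MvPowerSeries TwoColorTL.Color 𝕜) Q (TwoColorTL.coeff jwHat d) =
          TwoColorTL.coeff jwGen d := by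
  have : IsDomain (MvPowerSeries TwoColorTL.Color 𝕜) := NoZeroDivisors.to_isDomain _
  have hJ := TwoColorTL.isJonesWenzl_iff.1 hjw
  obtain ⟨e, hk, h1, he⟩ := hJ.2.exists_lift (TwoColorTL.constantCoeff_comp_deformation 𝕜)
    (TwoColorTL.constantCoeff_surjective _ 𝕜) hJ.1
  have hHat : TwoColorTL.IsJonesWenzl e := TwoColorTL.isJonesWenzl_iff.2 ⟨h1, hk⟩
  have hGen : TwoColorTL.IsJonesWenzl (TwoColorTL.extend (TwoColorTL.deformation 𝕜)
      ((algebraMap (MvPowerSeries TwoColorTL.Color 𝕜) Q).comp (TwoColorTL.deformation 𝕜))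
      (algebraMap _ Q) ⟨n, u⟩ ⟨n, u⟩ e) :=
    TwoColorTL.isJonesWenzl_iff.2
      ⟨by rw [TwoColorTL.idCoeff_extend, h1, map_one], hk.extend rfl⟩
  -- `extend` and the functors `specialization` and `generic` all act by applying a ring
  -- homomorphism to each coefficient, so these identities hold by definition once `he` is known.
  exact ⟨e, _, ⟨hHat, fun _ h => h.unique hHat⟩, ⟨hGen, fun _ h => h.unique hGen⟩, he, rfl,
    fun d => ⟨congrArg (fun f => TwoColorTL.coeff f d) he, rfl⟩⟩
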